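/- Let $q_n$ and $r_n=p_n-q_n$ be the numbers of relevant and irrelevant covariates at sample size $n$, with $q_n\to\infty$, $r_n\to\infty$. Let $\alpha_1,\alpha_3\in(-1,1)$ and $\alpha_2\in\mathbb R$ be constants such that, for every $n$, the block-exchangeable matrix $$C^n=\begin{pmatrix}C^n_{11}&C^n_{12}\\ C^n_{21}&C^n_{22}\end{pmatrix},\qquad (C^n_{11})_{ij}=\begin{cases}1&i=j\\ \alpha_1&i\ne j\end{cases},\quad (C^n_{22})_{ij}=\begin{cases}1&i=j\\ \alpha_3&i\ne j\end{cases},\quad (C^n_{12})_{ij}=(C^n_{21})_{ji}=\alpha_2,$$ with blocks of sizes $q_n$ and $r_n$, is positive definite. Put $D^n=(d_{ij})=(C^n)^{-1}$. For each $n$ we observe $y=X\beta+\varepsilon$, where $X$ is an $n\times p_n$ matrix with independent $N(0,C^n)$ rows, $\varepsilon\sim N(0,\sigma_n^2I_n)$ is independent of $X$, $\sigma_n>0$ is bounded in $n$, and $\beta=\beta^n\in\mathbb R^{p_n}$ has $\beta_j\neq0$ if and only if $j\le q_n$. Let $\gamma_j=\rho_js_j$ be the semi-standard partial covariance (SPAC)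 of the response $Y$ and the $j$-th covariate $X_j$: $\rho_j$ is the partial correlation of $Y$ and $X_j$ given the other covariates $X_{-j}$, and $s_j^2=\mathrm{Var}(Y\mid X_{-j})$. Let $m_n=|\sum_{i\le q_n}\mathrm{sign}(\beta_i)|$ and assume $m_n\to\infty$. Let $\underline L=\liminf_n q_n/m_n\in[1,\infty]$ (with $0\cdot\infty=0$ below). Given a tuning parameter $\lambda\ge 0$ and a random vector $\hat d=(\hat d_{11},\dots,\hat d_{p_np_n})$, a SPAC-Lasso estimate $\hat\gamma(\lambda)$ is any minimizer over $g\in\mathbb R^{p_n}$ of $$\tfrac12\Big\|y-\sum_{j}X_j\sqrt{\hat d_{jj}}\,g_j\Big\|^2+\lambda\sum_j\hat d_{jj}|g_j| .$$ Assume moreover the following regularity conditions. (i) For every $\delta>0$ there is $M>0$ such that, for large $n$, $\max_j|\hat d_{jj}-d_{jj}|\le M\sqrt{\log n/n}$ with probability at least $1-O(n^{-\delta})$. (ii) $p_n=O(n^\kappa)$ for some $\kappa\ge0$, and $q_n=o((n/\log n)^{1/3})$. (iii) There are positive $l_n\le\min_{j\le q_n}|\gamma_j|$ and nonnegative $\lambda_n$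 with $\sqrt{q_nn\log n}=o(\lambda_n)$, $\sqrt{q_n}\lambda_n/n\to0$ and $\sqrt{q_n}\lambda_n/n=o(l_n)$. Suppose that there is a constant $\eta>0$ with $$|\alpha_2|\le(1-\eta)\sqrt{\frac{1-\alpha_1}{1-\alpha_3}}\;\alpha_1\,\underline L .$$ Then the following hold. (a) The transformed strong irrepresentable condition holds: there is a constant $\eta'>0$ such that for all sufficiently large $n$, element-wise, $$\big|V(2)C^n_{21}(C^n_{11})^{-1}V(1)^{-1}\mathrm{sign}(\gamma_{(1)})\big|\le 1-\eta',$$ where $V(1)=\mathrm{diag}(\sqrt{1/d_{jj}})_{j\le q_n}$, $V(2)=\mathrm{diag}(\sqrt{1/d_{jj}})_{j>q_n}$, $\gamma_{(1)}=(\gamma_1,\dots,\gamma_{q_n})$. (b) SPAC-Lasso is strongly sign consistent: there is a data-independent sequence of tuning parameters (and the $\lambda_n$ of (iii) is one) along which, with probability tending to $1$, a minimizer $\hat\gamma(\lambda_n)$ exists and every minimizer satisfies $\mathrm{sign}(\hat\gamma(\lambda_n))=\mathrm{sign}(\gamma)$. -/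

import Mathlib

open MeasureTheory ProbabilityTheory Filter Topology Asymptotics Matrix

noncomputable section

/-- Covariance matrix of `(Y, X)` (with `none` the index of `Y`) when `Y = ∑ j, β j * X j + ε`,
`Cov X = C`, `Var ε = σ ^ 2` and `ε` is uncorrelated with `X`. -/
def jointCov {ι : Type*} [Fintype ι] (C : Matrix ι ι ℝ) (β : ι → ℝ) (σ : ℝ) :
    Matrix (Option ι) (Option ι) ℝ :=
  Matrix.of fun u v =>
    match u, v with
    | none, none => β ⬝ᵥ (C *ᵥ β) + σ ^ 2
    | none, some j => (C *ᵥ β) j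
    | some i, none => (C *ᵥ β) i
    | some i, some j => C i j

/-- Covariance of the errors of the best linear predictions of the variables `u` and `v` from
`X_{-j} = (X_k)_{k ≠ j}`, where `S` is the covariance matrix of `(Y, X)`. Under joint normality it is
the conditional covariance of `u` and `v` given `X_{-j}`. -/
def partialCov {ι : Type*} [Fintype ι] [DecidableEq ι] (S : Matrix (Option ι) (Option ι) ℝ)
    (j : ι) (u v : Option ι) : ℝ :=
  S u v - (fun k : {k : ι // k ≠ j} => S u (some k.1)) ⬝ᵥ
    ((S.submatrix (fun k : {k : ι // k ≠ j} => some k.1)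
        (fun k : {k : ι // k ≠ j} => some k.1))⁻¹ *ᵥ
      fun k : {k : ι // k ≠ j} => S (some k.1) v)

/-- Partial correlation `ρ_j` between the response and the `j`-th covariate. -/
def partialCorr {ι : Type*} [Fintype ι] [DecidableEq ι] (S : Matrix (Option ι) (Option ι) ℝ)
    (j : ι) : ℝ :=
  partialCov S j none (some j) /
    (√(partialCov S j none none) * √(partialCov S j (some j) (some j)))

/-- Semi-standard partial covariance (SPAC) `γ_j = ρ_j s_j`, with `s_j = √Var(Y | X_{-j})`. -/
def spac {ι : Type*} [Fintype ι] [DecidableEq ι] (S : Matrix (Option ι) (Option ι) ℝ)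
    (j : ι) : ℝ :=
  partialCorr S j * √(partialCov S j none none)

/-- The block-exchangeable covariance matrix of `q` relevant and `r` irrelevant covariates. -/
def exchangeableCov (q r : ℕ) (α₁ α₂ α₃ : ℝ) : Matrix (Fin q ⊕ Fin r) (Fin q ⊕ Fin r) ℝ :=
  Matrix.fromBlocks
    (Matrix.of fun i j => if i = j then 1 else α₁)
    (Matrix.of fun _ _ => α₂)
    (Matrix.of fun _ _ => α₂)
    (Matrix.of fun i j => if i = j then 1 else α₃)

/-- `m = |∑ sign (β_i)|`, the sum over the relevant covariates. -/
def signImbalance {q r : ℕ} (β : Fin q ⊕ Fin r → ℝ) : ℕ :=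
  (∑ i : Fin q, (SignType.sign (β (Sum.inl i)) : ℤ)).natAbs

/-- The vector `V(2) C₂₁ C₁₁⁻¹ V(1)⁻¹ sign(γ₍₁₎)`, where `V(1)` and `V(2)` are the diagonal matrices
with entries `√(1 / d_jj)`, `D = C⁻¹`, on the relevant and on the irrelevant covariates. -/
def transformedIrrepVector {q r : ℕ} (C : Matrix (Fin q ⊕ Fin r) (Fin q ⊕ Fin r) ℝ)
    (γ : Fin q ⊕ Fin r → ℝ) : Fin r → ℝ :=
  (Matrix.diagonal (fun j : Fin r => √(1 / C⁻¹ (Sum.inr j) (Sum.inr j))) * C.toBlocks₂₁ *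
    C.toBlocks₁₁⁻¹ *
    (Matrix.diagonal (fun i : Fin q => √(1 / C⁻¹ (Sum.inl i) (Sum.inl i))))⁻¹) *ᵥ
      fun i : Fin q => (SignType.sign (γ (Sum.inl i)) : ℝ)

/-- Transformed strong irrepresentable condition for growing dimensions: one constant `η > 0`
bounds all entries away from `1`, for all sufficiently large `n`. -/
def TransformedStrongIrrepresentable (q r : ℕ → ℕ)
    (C : ∀ n, Matrix (Fin (q n) ⊕ Fin (r n)) (Fin (q n) ⊕ Fin (r n)) ℝ)
    (γ : ∀ n, Fin (q n) ⊕ Fin (r n) → ℝ) : Prop :=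
  ∃ η : ℝ, 0 < η ∧ ∀ᶠ n in atTop, ∀ j, |transformedIrrepVector (C n) (γ n) j| ≤ 1 - η

/-- `n` independent `N(0, C)` rows and an independent `N(0, σ² I_n)` noise vector. -/
structure IsGaussianSample {Ω : Type*} [MeasurableSpace Ω] (μ : Measure Ω) {ι : Type*} [Fintype ι]
    [DecidableEq ι] {n : ℕ} (C : Matrix ι ι ℝ) (σ : ℝ)
    (x : Ω → Fin n → EuclideanSpace ℝ ι) (ε : Ω → Fin n → ℝ) : Prop where
  row_law : ∀ i, HasLaw (fun ω => x ω i) (multivariateGaussian 0 C) μ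
  row_indep : iIndepFun (fun i ω => x ω i) μ
  noise_law : ∀ i, HasLaw (fun ω => ε ω i) (gaussianReal 0 ⟨σ ^ 2, sq_nonneg σ⟩) μ
  noise_indep : iIndepFun (fun i ω => ε ω i) μ
  indep : IndepFun x ε μ

/-- The response `y = X β + ε`. -/
def response {ι : Type*} [Fintype ι] {n : ℕ} (x : Fin n → EuclideanSpace ℝ ι) (β : ι → ℝ)
    (ε : Fin n → ℝ) : Fin n → ℝ :=
  fun i => ∑ j, x i j * β j + ε i

/-- The SPAC-Lasso objective `½ ‖y - ∑ X_j √d̂_jj γ_j‖² + λ ∑ d̂_jj |γ_j|`. -/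
def spacLassoLoss {ι : Type*} [Fintype ι] {n : ℕ} (x : Fin n → EuclideanSpace ℝ ι)
    (y : Fin n → ℝ) (d : ι → ℝ) (lam : ℝ) (g : ι → ℝ) : ℝ :=
  1 / 2 * ∑ i, (y i - ∑ j, x i j * √(d j) * g j) ^ 2 + lam * ∑ j, d j * |g j|

/-- `g` is a SPAC-Lasso estimate: a global minimizer of the objective. -/
def IsSpacLasso {ι : Type*} [Fintype ι] {n : ℕ} (x : Fin n → EuclideanSpace ℝ ι)
    (y : Fin n → ℝ) (d : ι → ℝ) (lam : ℝ) (g : ι → ℝ) : Prop :=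
  ∀ h : ι → ℝ, spacLassoLoss x y d lam g ≤ spacLassoLoss x y d lam h

/-- With probability tending to one, SPAC-Lasso with the tuning parameters `lam n` has a solution
and every solution has the signs of `γ n`. (Stated as: the complementary event is asymptotically
null, so that the measurability of the set of `ω` plays no role.) -/
def SignConsistentAlong {Ω : Type*} [MeasurableSpace Ω] (μ : Measure Ω) (q r : ℕ → ℕ)
    (x : ∀ n, Ω → Fin n → EuclideanSpace ℝ (Fin (q n) ⊕ Fin (r n)))
    (y : ∀ n, Ω → Fin n → ℝ) (dhat : ∀ n, Ω → Fin (q n) ⊕ Fin (r n) → ℝ)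
    (γ : ∀ n, Fin (q n) ⊕ Fin (r n) → ℝ) (lam : ℕ → ℝ) : Prop :=
  Tendsto (fun n => μ {ω | ¬ ((∃ g, IsSpacLasso (x n ω) (y n ω) (dhat n ω) (lam n) g) ∧
    ∀ g, IsSpacLasso (x n ω) (y n ω) (dhat n ω) (lam n) g →
      ∀ j, SignType.sign (g j) = SignType.sign (γ n j))}) atTop (𝓝 0)

/-- Strong sign consistency: sign consistency along some data-independent choice of `λ_n`. -/
def StronglySignConsistent {Ω : Type*} [MeasurableSpace Ω] (μ : Measure Ω) (q r : ℕ → ℕ)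
    (x : ∀ n, Ω → Fin n → EuclideanSpace ℝ (Fin (q n) ⊕ Fin (r n)))
    (y : ∀ n, Ω → Fin n → ℝ) (dhat : ∀ n, Ω → Fin (q n) ⊕ Fin (r n) → ℝ)
    (γ : ∀ n, Fin (q n) ⊕ Fin (r n) → ℝ) : Prop :=
  ∃ lam : ℕ → ℝ, (∀ n, 0 ≤ lam n) ∧ SignConsistentAlong μ q r x y dhat γ lam

/-- Accuracy of the estimator `dhat` of the diagonal of the precision matrix: for every `δ > 0`
there is `M > 0` such that, for large `n`, `max_j |d̂_jj - d_jj| ≤ M √(log n / n)` holds with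
probability at least `1 - O(n^{-δ})`. -/
def PrecisionEstimatorAccurate {Ω : Type*} [MeasurableSpace Ω] (μ : Measure Ω) (q r : ℕ → ℕ)
    (C : ∀ n, Matrix (Fin (q n) ⊕ Fin (r n)) (Fin (q n) ⊕ Fin (r n)) ℝ)
    (dhat : ∀ n, Ω → Fin (q n) ⊕ Fin (r n) → ℝ) : Prop :=
  ∀ δ : ℝ, 0 < δ → ∃ M : ℝ, 0 < M ∧ ∃ K : ℝ, ∀ᶠ n : ℕ in atTop,
    μ {ω | ¬ ∀ j, |dhat n ω j - (C n)⁻¹ j j| ≤ M * √(Real.log n / n)} ≤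
      ENNReal.ofReal (K * (n : ℝ) ^ (-δ))

end

/-!
In the variables `h_j = √d̂_jj g_j` the SPAC-Lasso objective is that of a weighted Lasso with
weights `λ √d̂_jj`. A weighted Lasso recovers the signs of the coefficients if its
Karush–Kuhn–Tucker conditions, solved on the relevant covariates, hold strictly on the irrelevant
ones (the primal–dual witness). For the exact covariance matrix this strictness is the transformed
irrepresentable condition, and it survives a small perturbation of the sample moments and of `d̂`.
By Gaussian concentration for `∑ f_i g_i = ∑ ((f_i + g_i) ^ 2 - (f_i - g_i) ^ 2) / 4`, every moment
is within `O(√(log n / n))` of its expectation, with probability tending to one.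

Let `C` be exchangeable and `D = C⁻¹`. Positive definiteness for block sizes tending to infinity
forces the quadratic form `α₁ u² + 2 α₂ u w + α₃ w²` to be nonnegative. Hence `C` is coercive
uniformly in `n`, and variational bounds for `D` give `d_ii ≤ 1 / (1 - α₁)` on the relevant and
`d_jj ≥ (1 - 1 / r) / (1 - α₃)` on the irrelevant covariates. As `C₂₁ C₁₁⁻¹` has all entries equal
to `α₂ / (1 - α₁ + q α₁)`, the assumed bound on `|α₂|` makes the transformed irrepresentable vector
less than one in the limit.
-/

open scoped NNReal

section GaussianConcentration

lemma integral_exp_mul_sq_gaussianReal (v : ℝ≥0) {s : ℝ} (hs : 2 * s * v < 1) :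
    ∫ x, Real.exp (s * x ^ 2) ∂(gaussianReal 0 v) = 1 / √(1 - 2 * s * v) := by
  rcases eq_or_ne v 0 with rfl | hv
  · simp [gaussianReal_zero_var]
  have : (0 : ℝ) < v := by positivity
  have hs' : (1 : ℝ) - 2 * s * v ≠ 0 := by linarith
  have hdensity (x : ℝ) : gaussianPDFReal 0 v x • Real.exp (s * x ^ 2) =
      (√(2 * Real.pi * v))⁻¹ * Real.exp (-(1 / (2 * v) - s) * x ^ 2) := by
    rw [gaussianPDFReal, smul_eq_mul, mul_assoc, ← Real.exp_add]
    congr 2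
    field_simp
    ring
  have hscale : Real.pi / (1 / (2 * v) - s) = (2 * Real.pi * v) / (1 - 2 * s * v) := by
    rw [show 1 / (2 * (v : ℝ)) - s = (1 - 2 * s * v) / (2 * v) by field_simp]
    field_simp
  rw [integral_gaussianReal_eq_integral_smul hv]
  simp_rw [hdensity]
  rw [integral_const_mul, integral_gaussian, hscale, Real.sqrt_div (by positivity)]
  field_simp

lemma integrable_exp_mul_sq_gaussianReal (v : ℝ≥0) {s : ℝ} (hs : 2 * s * v < 1) :
    Integrable (fun x => Real.exp (s * x ^ 2)) (gaussianReal 0 v) := by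
  have : 0 < 1 - 2 * s * v := by linarith
  refine not_imp_comm.1 integral_undef ?_
  rw [integral_exp_mul_sq_gaussianReal v hs]
  positivity

lemma one_le_one_sub_mul_exp {y : ℝ} (hy : |y| ≤ 1 / 2) :
    1 ≤ (1 - y) * Real.exp (y + y ^ 2) := by
  have h2 := (abs_le.1 hy).2
  rcases le_total y 0 with h | h
  · calc 1 ≤ (1 - y) * (y + y ^ 2 + 1) := by
          nlinarith [mul_nonneg (neg_nonneg.2 h) (sq_nonneg y)]
      _ ≤ (1 - y) * Real.exp (y + y ^ 2) :=
          mul_le_mul_of_nonneg_left (Real.add_one_le_exp _) (by linarith)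
  · have : 0 ≤ 1 / 2 - y := by linarith
    have hrest : 0 ≤ y ^ 2 * ((1 / 2 - y) * (1 + y + y ^ 2)) := by positivity
    calc 1 ≤ (1 - y) * (1 + (y + y ^ 2) + (y + y ^ 2) ^ 2 / 2) := by
          nlinarith [pow_nonneg h 3, pow_nonneg h 4, pow_nonneg h 5]
      _ ≤ (1 - y) * Real.exp (y + y ^ 2) :=
          mul_le_mul_of_nonneg_left (Real.quadratic_le_exp_of_nonneg (by positivity)) (by linarith)

lemma one_div_sqrt_one_sub_mul_exp_neg_le {x : ℝ} (hx : |x| ≤ 1 / 4) :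
    1 / √(1 - 2 * x) * Real.exp (-x) ≤ Real.exp (2 * x ^ 2) := by
  have hpos : 0 < 1 - 2 * x := by linarith [(abs_le.1 hx).2]
  have hsq : (√(1 - 2 * x) * Real.exp (x + 2 * x ^ 2)) ^ 2 =
      (1 - 2 * x) * Real.exp (2 * x + (2 * x) ^ 2) := by
    rw [mul_pow, Real.sq_sqrt hpos.le, ← Real.exp_nat_mul]
    congr 2
    push_cast
    ring
  have hone : 1 ≤ √(1 - 2 * x) * Real.exp (x + 2 * x ^ 2) := by
    refine (one_le_sq_iff₀ (by positivity)).1 (hsq ▸ one_le_one_sub_mul_exp ?_)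
    rw [abs_mul, abs_two]
    linarith
  rw [div_mul_eq_mul_div, one_mul, div_le_iff₀ (Real.sqrt_pos.2 hpos)]
  calc Real.exp (-x) ≤ Real.exp (-x) * (√(1 - 2 * x) * Real.exp (x + 2 * x ^ 2)) :=
        le_mul_of_one_le_right (Real.exp_pos _).le hone
    _ = (Real.exp (-x) * Real.exp (x + 2 * x ^ 2)) * √(1 - 2 * x) := by ring
    _ = Real.exp (2 * x ^ 2) * √(1 - 2 * x) := by rw [← Real.exp_add]; congr 2; ring

variable {Ω : Type*} [MeasurableSpace Ω] {μ : Measure Ω}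

lemma integrable_exp_mul_sq_sub_of_hasLaw {U : Ω → ℝ} {v : ℝ≥0}
    (hU : HasLaw U (gaussianReal 0 v) μ) {s : ℝ} (hs : |s| * v ≤ 1 / 4) :
    Integrable (fun ω => Real.exp (s * (U ω ^ 2 - v))) μ := by
  have h := integrable_exp_mul_sq_gaussianReal v (s := s)
    (by nlinarith [le_abs_self s, v.coe_nonneg])
  rw [← hU.map_eq] at h
  refine ((h.comp_aemeasurable hU.aemeasurable).mul_const (Real.exp (-(s * v)))).congr
    (ae_of_all _ fun ω => ?_)
  simp only [Function.comp_apply, ← Real.exp_add]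
  ring_nf

lemma mgf_sq_sub_le_of_hasLaw {U : Ω → ℝ} {v : ℝ≥0} (hU : HasLaw U (gaussianReal 0 v) μ)
    {s : ℝ} (hs : |s| * v ≤ 1 / 4) :
    mgf (fun ω => U ω ^ 2 - v) μ s ≤ Real.exp (2 * (s * v) ^ 2) := by
  have hsv : 2 * s * v < 1 := by nlinarith [le_abs_self s, v.coe_nonneg]
  have hU2 : ∫ ω, Real.exp (s * U ω ^ 2) ∂μ = 1 / √(1 - 2 * s * v) := by
    rw [← integral_exp_mul_sq_gaussianReal v hsv]
    exact hU.integral_comp (f := fun x => Real.exp (s * x ^ 2)) (by fun_prop)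
  calc mgf (fun ω => U ω ^ 2 - v) μ s
      = (∫ ω, Real.exp (s * U ω ^ 2) ∂μ) * Real.exp (-(s * v)) := by
        rw [mgf, ← integral_mul_const]
        refine integral_congr_ae (ae_of_all _ fun ω => ?_)
        simp only [← Real.exp_add]
        ring_nf
    _ = 1 / √(1 - 2 * (s * v)) * Real.exp (-(s * v)) := by rw [hU2, mul_assoc 2 s]
    _ ≤ Real.exp (2 * (s * v) ^ 2) :=
        one_div_sqrt_one_sub_mul_exp_neg_le (by rwa [abs_mul, abs_of_nonneg v.coe_nonneg])

lemma measureReal_le_abs_le_of_mgf_le [IsFiniteMeasure μ] {S : Ω → ℝ} {s a : ℝ} (u : ℝ)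
    (hs : 0 ≤ s) (hint : ∀ s', |s'| = s → Integrable (fun ω => Real.exp (s' * S ω)) μ)
    (hmgf : ∀ s', |s'| = s → mgf S μ s' ≤ Real.exp a) :
    μ.real {ω | u ≤ |S ω|} ≤ 2 * Real.exp (a - s * u) := by
  have habs : |(-s)| = s := by rw [abs_neg, abs_of_nonneg hs]
  have hupper : μ.real {ω | u ≤ S ω} ≤ Real.exp (a - s * u) :=
    calc μ.real {ω | u ≤ S ω} ≤ Real.exp (-s * u) * mgf S μ s :=
          measure_ge_le_exp_mul_mgf u hs (hint s (abs_of_nonneg hs))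
      _ ≤ Real.exp (-s * u) * Real.exp a := by gcongr; exact hmgf s (abs_of_nonneg hs)
      _ = Real.exp (a - s * u) := by rw [← Real.exp_add]; ring_nf
  have hlower : μ.real {ω | S ω ≤ -u} ≤ Real.exp (a - s * u) :=
    calc μ.real {ω | S ω ≤ -u} ≤ Real.exp (-(-s) * -u) * mgf S μ (-s) :=
          measure_le_le_exp_mul_mgf (-u) (neg_nonpos.2 hs) (hint (-s) habs)
      _ ≤ Real.exp (-(-s) * -u) * Real.exp a := by gcongr; exact hmgf (-s) habs
      _ = Real.exp (a - s * u) := by rw [← Real.exp_add]; ring_nf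
  calc μ.real {ω | u ≤ |S ω|} ≤ μ.real ({ω | u ≤ S ω} ∪ {ω | S ω ≤ -u}) :=
        measureReal_mono fun ω (hω : u ≤ |S ω|) => (le_abs.1 hω).imp id le_neg_of_le_neg
    _ ≤ 2 * Real.exp (a - s * u) := by
        linarith [measureReal_union_le (μ := μ) {ω | u ≤ S ω} {ω | S ω ≤ -u}]

variable [IsProbabilityMeasure μ] {m : Type*} [Fintype m]

lemma measureReal_le_abs_sum_sq_sub_le {U : m → Ω → ℝ} {v : ℝ≥0}
    (hU : ∀ i, HasLaw (U i) (gaussianReal 0 v) μ) (hind : iIndepFun U μ)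
    {V t : ℝ} (hV : 0 < V) (hvV : v ≤ V) (ht0 : 0 ≤ t) (htV : t ≤ V) :
    μ.real {ω | Fintype.card m * t ≤ |∑ i, (U i ω ^ 2 - v)|} ≤
      2 * Real.exp (-(Fintype.card m * t ^ 2 / (8 * V ^ 2))) := by
  -- the minimizer over `s` of the Chernoff exponent `card m * (2 * (s * V) ^ 2 - s * t)`
  set s : ℝ := t / (4 * V ^ 2) with hs
  have hind' : iIndepFun (fun i ω => U i ω ^ 2 - (v : ℝ)) μ :=
    hind.comp (fun _ x => x ^ 2 - (v : ℝ)) (fun _ => by fun_prop)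
  have hmeas i : AEMeasurable (fun ω => U i ω ^ 2 - (v : ℝ)) μ :=
    ((hU i).aemeasurable.pow_const 2).sub_const _
  have hsv : s * v ≤ 1 / 4 :=
    calc s * v ≤ s * V := by gcongr
      _ = t / V / 4 := by rw [hs]; field_simp
      _ ≤ 1 / 4 := by gcongr; exact (div_le_one hV).2 htV
  have hmgf {s' : ℝ} (hs' : |s'| = s) : mgf (fun ω => ∑ i, (U i ω ^ 2 - (v : ℝ))) μ s' ≤
      Real.exp (Fintype.card m * (2 * (s * V) ^ 2)) := by
    rw [← Finset.sum_fn, hind'.mgf_sum₀ hmeas, Real.exp_nat_mul, ← Finset.card_univ,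
      ← Finset.prod_const]
    refine Finset.prod_le_prod (fun i _ => mgf_nonneg) fun i _ =>
      (mgf_sq_sub_le_of_hasLaw (hU i) (hs'.symm ▸ hsv)).trans ?_
    rw [Real.exp_le_exp, mul_pow, ← sq_abs s', hs', ← mul_pow]
    gcongr
  have hint {s' : ℝ} (hs' : |s'| = s) :
      Integrable (fun ω => Real.exp (s' * ∑ i, (U i ω ^ 2 - (v : ℝ)))) μ := by
    have hprod := hind'.mgf_sum₀ (t := s') hmeas Finset.univ
    rw [Finset.sum_fn] at hprod
    refine not_imp_comm.1 integral_undef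
      (hprod.trans_ne (Finset.prod_pos fun i _ => mgf_pos ?_).ne')
    exact integrable_exp_mul_sq_sub_of_hasLaw (hU i) (hs'.symm ▸ hsv)
  refine (measureReal_le_abs_le_of_mgf_le _ (by positivity) (fun _ => hint)
    fun _ => hmgf).trans_eq ?_
  rw [hs]
  congr 2
  field_simp
  ring

lemma measureReal_lt_abs_sum_mul_sub_le {f g : m → Ω → ℝ} {v₁ v₂ : ℝ≥0}
    (h₁ : ∀ i, HasLaw (fun ω => f i ω + g i ω) (gaussianReal 0 v₁) μ)
    (h₂ : ∀ i, HasLaw (fun ω => f i ω - g i ω) (gaussianReal 0 v₂) μ)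
    (hi₁ : iIndepFun (fun i ω => f i ω + g i ω) μ) (hi₂ : iIndepFun (fun i ω => f i ω - g i ω) μ)
    {V t c : ℝ} (hV : 0 < V) (hv₁ : v₁ ≤ V) (hv₂ : v₂ ≤ V) (ht0 : 0 ≤ t) (htV : t ≤ V)
    (hc : (v₁ : ℝ) - v₂ = 4 * c) :
    μ.real {ω | Fintype.card m * t < |∑ i, f i ω * g i ω - Fintype.card m * c|} ≤
      4 * Real.exp (-(Fintype.card m * t ^ 2 / (8 * V ^ 2))) := by
  have hadd := measureReal_le_abs_sum_sq_sub_le h₁ hi₁ hV hv₁ ht0 htV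
  have hsub := measureReal_le_abs_sum_sq_sub_le h₂ hi₂ hV hv₂ ht0 htV
  set P : Ω → ℝ := fun ω => ∑ i, ((f i ω + g i ω) ^ 2 - (v₁ : ℝ))
  set Q : Ω → ℝ := fun ω => ∑ i, ((f i ω - g i ω) ^ 2 - (v₂ : ℝ))
  have polarization ω :
      ∑ i, f i ω * g i ω - Fintype.card m * c = (P ω - Q ω) / 4 := by
    have hterm i : (f i ω + g i ω) ^ 2 - (v₁ : ℝ) - ((f i ω - g i ω) ^ 2 - v₂) =
        4 * (f i ω * g i ω - c) := by linear_combination -hc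
    simp only [P, Q, ← Finset.sum_sub_distrib, hterm, ← Finset.mul_sum]
    simp
  have hsubset : {ω | Fintype.card m * t < |∑ i, f i ω * g i ω - Fintype.card m * c|} ⊆
      {ω | Fintype.card m * t ≤ |P ω|} ∪ {ω | Fintype.card m * t ≤ |Q ω|} := by
    intro ω hω
    rw [Set.mem_ofPred_eq, polarization, abs_div, Nat.abs_ofNat] at hω
    by_contra! hsmall
    simp only [Set.mem_union, Set.mem_ofPred_eq, not_or, not_le] at hsmall
    linarith [abs_sub (P ω) (Q ω), abs_nonneg (P ω)]
  linarith [measureReal_mono (μ := μ) hsubset,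
    measureReal_union_le (μ := μ) {ω | Fintype.card m * t ≤ |P ω|} {ω | Fintype.card m * t ≤ |Q ω|}]

end GaussianConcentration

section GaussianSample

/-- The design matrix of a sample: its rows are the observed covariate vectors. -/
def designMatrix {ι : Type*} {n : ℕ} (x : Fin n → EuclideanSpace ℝ ι) : Matrix (Fin n) ι ℝ :=
  Matrix.of fun i j => x i j

/-- The good event of the analysis: each entry of the Gram matrix `XᵀX` and of the noise
correlations `Xᵀe`, divided by the sample size, is within `t` of its expectation (`C` and `0`). It
is stated without division. -/
structure SampleMomentsClose {m ι : Type*} [Fintype m] (X : Matrix m ι ℝ) (e : m → ℝ)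
    (C : Matrix ι ι ℝ) (t : ℝ) : Prop where
  gram : ∀ k l, |(Xᵀ * X) k l - Fintype.card m * C k l| ≤ Fintype.card m * t
  noise : ∀ k, |(Xᵀ *ᵥ e) k| ≤ Fintype.card m * t

lemma iIndepFun_prodMk_of_indepFun {Ω : Type*} [MeasurableSpace Ω] {μ : Measure Ω}
    [IsProbabilityMeasure μ] {ι α δ : Type*} [Finite ι] [MeasurableSpace α] [MeasurableSpace δ]
    {f : ι → Ω → α} {g : ι → Ω → δ} (hf : ∀ i, AEMeasurable (f i) μ)
    (hg : ∀ i, AEMeasurable (g i) μ) (hfi : iIndepFun f μ) (hgi : iIndepFun g μ)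
    (hfg : IndepFun (fun ω i => f i ω) (fun ω i => g i ω) μ) :
    iIndepFun (fun i ω => (f i ω, g i ω)) μ := by
  have := Fintype.ofFinite ι
  have : ∀ i, IsProbabilityMeasure (μ.map (f i)) := fun i =>
    Measure.isProbabilityMeasure_map (hf i)
  have : ∀ i, IsProbabilityMeasure (μ.map (g i)) := fun i =>
    Measure.isProbabilityMeasure_map (hg i)
  have hF : AEMeasurable (fun ω i => f i ω) μ := aemeasurable_pi_lambda _ hf
  have hG : AEMeasurable (fun ω i => g i ω) μ := aemeasurable_pi_lambda _ hg
  have hjoint : μ.map (fun ω => (fun i => f i ω, fun i => g i ω)) =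
      (Measure.pi fun i => μ.map (f i)).prod (Measure.pi fun i => μ.map (g i)) := by
    rw [(indepFun_iff_map_prod_eq_prod_map_map hF hG).1 hfg, hfi.map_fun_eq_pi_map hf,
      hgi.map_fun_eq_pi_map hg]
  have hpair i : μ.map (fun ω => (f i ω, g i ω)) = (μ.map (f i)).prod (μ.map (g i)) :=
    (indepFun_iff_map_prod_eq_prod_map_map (hf i) (hg i)).1
      (hfg.comp (measurable_pi_apply i) (measurable_pi_apply i))
  rw [iIndepFun_iff_map_fun_eq_pi_map fun i => (hf i).prodMk (hg i)]
  simp_rw [hpair]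
  rw [← (measurePreserving_arrowProdEquivProdArrow α δ ι (fun i => μ.map (f i))
    (fun i => μ.map (g i))).symm.map_eq, ← hjoint, AEMeasurable.map_map_of_aemeasurable
    (MeasurableEquiv.measurable _).aemeasurable (hF.prodMk hG)]
  rfl

section Marginals

lemma hasLaw_add_gaussianReal_zero {Ω : Type*} [MeasurableSpace Ω] {μ : Measure Ω} {f g : Ω → ℝ}
    {u v : ℝ≥0} (hf : HasLaw f (gaussianReal 0 u) μ) (hg : HasLaw g (gaussianReal 0 v) μ)
    (hfg : IndepFun f g μ) : HasLaw (fun ω => f ω + g ω) (gaussianReal 0 (u + v)) μ where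
  aemeasurable := hf.aemeasurable.add hg.aemeasurable
  map_eq := (gaussianReal_add_gaussianReal_of_indepFun hfg hf.map_eq hg.map_eq).trans
    (by rw [add_zero])

variable {ι : Type*} [Fintype ι] [DecidableEq ι] {C : Matrix ι ι ℝ}

lemma hasLaw_inner_multivariateGaussian (hC : C.PosSemidef) (w : EuclideanSpace ℝ ι) :
    HasLaw (fun x => inner ℝ w x) (gaussianReal 0 (w ⬝ᵥ C *ᵥ w).toNNReal)
      (multivariateGaussian 0 C) where
  aemeasurable := by fun_prop
  map_eq := by
    have hmap := IsGaussian.map_eq_gaussianReal (μ := multivariateGaussian 0 C) (innerSL ℝ w)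
    have hinner : (fun x => inner ℝ w x) = ⇑(innerSL ℝ w) := by ext; simp
    rw [hinner, hmap, ContinuousLinearMap.integral_comp_id_comm IsGaussian.integrable_id,
      integral_id_multivariateGaussian, map_zero, ← hinner,
      ← covarianceBilin_self IsGaussian.memLp_two_id, covarianceBilin_multivariateGaussian hC]

lemma dotProduct_mulVec_single_add_single (C : Matrix ι ι ℝ) (a b : ι) (s : ℝ) :
    (Pi.single a 1 + Pi.single b s) ⬝ᵥ C *ᵥ (Pi.single a 1 + Pi.single b s) =
      C a a + s * (C a b + C b a) + s ^ 2 * C b b := by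
  simp [Matrix.mulVec_add, add_dotProduct, dotProduct_add]
  ring

lemma hasLaw_add_mul_multivariateGaussian (hC : C.PosSemidef) (a b : ι) (s : ℝ) :
    HasLaw (fun x : EuclideanSpace ℝ ι => x a + s * x b)
      (gaussianReal 0 (C a a + s * (C a b + C b a) + s ^ 2 * C b b).toNNReal)
      (multivariateGaussian 0 C) := by
  have h := hasLaw_inner_multivariateGaussian hC
    (EuclideanSpace.single a 1 + EuclideanSpace.single b s)
  rw [← dotProduct_mulVec_single_add_single]
  simpa [inner_add_left, EuclideanSpace.inner_single_left] using h

end Marginals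

section Concentration

variable {Ω : Type*} [MeasurableSpace Ω] {μ : Measure Ω} [IsProbabilityMeasure μ]
  {ι : Type*} [Fintype ι] [DecidableEq ι] {n : ℕ} {C : Matrix ι ι ℝ} {σ V t : ℝ}
  {x : Ω → Fin n → EuclideanSpace ℝ ι} {ε : Ω → Fin n → ℝ}

lemma IsGaussianSample.measureReal_lt_abs_gram_sub_le (h : IsGaussianSample μ C σ x ε)
    (hC : C.PosSemidef) (hV0 : 0 < V) (hV : ∀ k, 4 * C k k ≤ V) (a b : ι) (ht0 : 0 ≤ t)
    (ht : t ≤ V) :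
    μ.real {ω | n * t < |∑ i, x ω i a * x ω i b - n * C a b|} ≤
      4 * Real.exp (-(n * t ^ 2 / (8 * V ^ 2))) := by
  have hsymm : C b a = C a b := by simpa using hC.isHermitian.apply a b
  have hnonneg s : 0 ≤ C a a + s * (C a b + C b a) + s ^ 2 * C b b := by
    rw [← dotProduct_mulVec_single_add_single]
    exact hC.dotProduct_mulVec_nonneg _
  have law s i := (hasLaw_add_mul_multivariateGaussian hC a b s).comp (h.row_law i)
  have ind (s : ℝ) : iIndepFun (fun i ω => x ω i a + s * x ω i b) μ :=
    h.row_indep.comp (fun _ (y : EuclideanSpace ℝ ι) => y a + s * y b) (fun _ => by fun_prop)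
  have key := measureReal_lt_abs_sum_mul_sub_le (f := fun i ω => x ω i a)
    (g := fun i ω => x ω i b) (c := C a b)
    (fun i => (law 1 i).congr (ae_of_all _ fun ω => by simp))
    (fun i => (law (-1) i).congr (ae_of_all _ fun ω => by simp [sub_eq_add_neg]))
    (by simpa using ind 1) (by simpa [sub_eq_add_neg] using ind (-1)) hV0
    (by rw [Real.coe_toNNReal _ (hnonneg _)]; linarith [hnonneg (-1), hV a, hV b])
    (by rw [Real.coe_toNNReal _ (hnonneg _)]; linarith [hnonneg 1, hV a, hV b])
    ht0 ht (by rw [Real.coe_toNNReal _ (hnonneg _), Real.coe_toNNReal _ (hnonneg _), hsymm]; ring)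
  simpa only [Fintype.card_fin] using key

lemma IsGaussianSample.measureReal_lt_abs_noise_le (h : IsGaussianSample μ C σ x ε)
    (hC : C.PosSemidef) (hV0 : 0 < V) (a : ι) (hV : C a a + σ ^ 2 ≤ V) (ht0 : 0 ≤ t)
    (ht : t ≤ V) :
    μ.real {ω | n * t < |∑ i, x ω i a * ε ω i|} ≤
      4 * Real.exp (-(n * t ^ 2 / (8 * V ^ 2))) := by
  have hrow i : HasLaw (fun ω => x ω i a) (gaussianReal 0 (C a a).toNNReal) μ := by
    simpa using (measurePreserving_eval_multivariateGaussian hC).fun_comp_hasLaw (h.row_law i)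
  obtain ⟨v, hvσ, hnoise⟩ : ∃ v : ℝ≥0, (v : ℝ) = σ ^ 2 ∧
      ∀ i, HasLaw (fun ω => ε ω i) (gaussianReal 0 v) μ := ⟨⟨σ ^ 2, sq_nonneg σ⟩, rfl, h.noise_law⟩
  have hneg i : HasLaw (fun ω => -ε ω i) (gaussianReal 0 v) μ :=
    neg_zero (G := ℝ) ▸ gaussianReal_neg (hnoise i)
  have hindep i : IndepFun (fun ω => x ω i a) (fun ω => ε ω i) μ :=
    h.indep.comp (φ := fun z : Fin n → EuclideanSpace ℝ ι => z i a) (ψ := fun z : Fin n → ℝ => z i)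
      (by fun_prop) (measurable_pi_apply i)
  have hpair := iIndepFun_prodMk_of_indepFun (fun i => (h.row_law i).aemeasurable)
    (fun i => (hnoise i).aemeasurable) h.row_indep h.noise_indep h.indep
  have hvar : (((C a a).toNNReal + v : ℝ≥0) : ℝ) ≤ V := by
    rwa [NNReal.coe_add, Real.coe_toNNReal _ hC.diag_nonneg, hvσ]
  have key := measureReal_lt_abs_sum_mul_sub_le (f := fun i ω => x ω i a)
    (g := fun i ω => ε ω i) (c := 0)
    (fun i => hasLaw_add_gaussianReal_zero (hrow i) (hnoise i) (hindep i))
    (fun i => by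
      simpa only [sub_eq_add_neg] using hasLaw_add_gaussianReal_zero (hrow i) (hneg i)
        ((hindep i).comp measurable_id measurable_neg))
    (hpair.comp (fun _ (y : EuclideanSpace ℝ ι × ℝ) => y.1 a + y.2) (fun _ => by fun_prop))
    (hpair.comp (fun _ (y : EuclideanSpace ℝ ι × ℝ) => y.1 a - y.2) (fun _ => by fun_prop))
    hV0 hvar hvar ht0 ht (by simp)
  simpa only [Fintype.card_fin, mul_zero, sub_zero] using key

lemma IsGaussianSample.measureReal_not_sampleMomentsClose_le (h : IsGaussianSample μ C σ x ε)
    (hC : C.PosSemidef) (hV0 : 0 < V) (hV : ∀ k, 4 * C k k + σ ^ 2 ≤ V) (ht0 : 0 ≤ t)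
    (ht : t ≤ V) :
    μ.real {ω | ¬ SampleMomentsClose (designMatrix (x ω)) (ε ω) C t} ≤
      8 * (Fintype.card ι : ℝ) ^ 2 * Real.exp (-(n * t ^ 2 / (8 * V ^ 2))) := by
  set E := Real.exp (-(n * t ^ 2 / (8 * V ^ 2)))
  have hsubset : {ω | ¬ SampleMomentsClose (designMatrix (x ω)) (ε ω) C t} ⊆
      (⋃ p : ι × ι, {ω | n * t < |∑ i, x ω i p.1 * x ω i p.2 - n * C p.1 p.2|}) ∪
      ⋃ k : ι, {ω | n * t < |∑ i, x ω i k * ε ω i|} := by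
    intro ω hω
    contrapose! hω
    simp only [Set.mem_union, Set.mem_iUnion, Set.mem_ofPred_eq, not_or, not_exists, not_lt] at hω
    simp only [Set.mem_ofPred_eq, not_not]
    exact ⟨fun k l => by simpa [designMatrix, Matrix.mul_apply] using hω.1 (k, l),
      fun k => by simpa [designMatrix, Matrix.mulVec, dotProduct] using hω.2 k⟩
  have hgram (p : ι × ι) : μ.real {ω | n * t < |∑ i, x ω i p.1 * x ω i p.2 - n * C p.1 p.2|} ≤
      4 * E := h.measureReal_lt_abs_gram_sub_le hC hV0
    (fun k => by linarith [hV k, sq_nonneg σ]) p.1 p.2 ht0 ht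
  have hnoise k : μ.real {ω | n * t < |∑ i, x ω i k * ε ω i|} ≤ 4 * E :=
    h.measureReal_lt_abs_noise_le hC hV0 k (by linarith [hV k, hC.diag_nonneg (i := k)]) ht0 ht
  have hcard : (Fintype.card ι : ℝ) ≤ (Fintype.card ι : ℝ) ^ 2 := by
    exact_mod_cast Nat.le_self_pow two_ne_zero _
  calc _ ≤ _ := measureReal_mono hsubset
    _ ≤ _ := measureReal_union_le _ _
    _ ≤ _ := add_le_add (measureReal_iUnion_fintype_le _) (measureReal_iUnion_fintype_le _)
    _ ≤ ∑ _p : ι × ι, 4 * E + ∑ _k : ι, 4 * E :=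
      add_le_add (Finset.sum_le_sum fun p _ => hgram p) (Finset.sum_le_sum fun k _ => hnoise k)
    _ = ((Fintype.card ι : ℝ) ^ 2 + Fintype.card ι) * (4 * E) := by
      simp only [Finset.sum_const, Finset.card_univ, Fintype.card_prod, nsmul_eq_mul, Nat.cast_mul]
      ring
    _ ≤ ((Fintype.card ι : ℝ) ^ 2 + (Fintype.card ι : ℝ) ^ 2) * (4 * E) := by gcongr
    _ = 8 * (Fintype.card ι : ℝ) ^ 2 * E := by ring

end Concentration

section Asymptotic

lemma tendsto_log_div_self_atTop : Tendsto (fun n : ℕ => Real.log n / n) atTop (𝓝 0) :=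
  Real.isLittleO_log_id_atTop.tendsto_div_nhds_zero.comp tendsto_natCast_atTop_atTop

variable {Ω : Type*} [MeasurableSpace Ω] {μ : Measure Ω}

lemma PrecisionEstimatorAccurate.exists_tendsto_measure_zero {q r : ℕ → ℕ}
    {C : ∀ n, Matrix (Fin (q n) ⊕ Fin (r n)) (Fin (q n) ⊕ Fin (r n)) ℝ}
    {dhat : ∀ n, Ω → Fin (q n) ⊕ Fin (r n) → ℝ} (h : PrecisionEstimatorAccurate μ q r C dhat) :
    ∃ M : ℝ, Tendsto (fun n => μ {ω | ¬ ∀ j, |dhat n ω j - (C n)⁻¹ j j| ≤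
      M * √(Real.log n / n)}) atTop (𝓝 0) := by
  obtain ⟨M, -, K, hK⟩ := h 1 one_pos
  have hlim : Tendsto (fun n : ℕ => ENNReal.ofReal (K * (n : ℝ) ^ (-1 : ℝ))) atTop (𝓝 0) := by
    simpa using ENNReal.tendsto_ofReal
      (((tendsto_rpow_neg_atTop one_pos).comp tendsto_natCast_atTop_atTop).const_mul K)
  exact ⟨M, tendsto_of_tendsto_of_tendsto_of_le_of_le' tendsto_const_nhds hlim
    (Eventually.of_forall fun _ => zero_le) hK⟩

variable [IsProbabilityMeasure μ]
  {ι : ℕ → Type*} [∀ n, Fintype (ι n)] [∀ n, DecidableEq (ι n)] {C : ∀ n, Matrix (ι n) (ι n) ℝ}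
  {σ : ℕ → ℝ} {x : ∀ n, Ω → Fin n → EuclideanSpace ℝ (ι n)} {ε : ∀ n, Ω → Fin n → ℝ}

lemma eventually_tendsto_measure_not_sampleMomentsClose (hC : ∀ᶠ n in atTop, (C n).PosSemidef)
    {V : ℝ} (hV0 : 0 < V) (hV : ∀ᶠ n in atTop, ∀ k, 4 * C n k k + σ n ^ 2 ≤ V)
    (hdata : ∀ n, IsGaussianSample μ (C n) (σ n) (x n) (ε n)) {κ : ℝ}
    (hp : (fun n => (Fintype.card (ι n) : ℝ)) =O[atTop] fun n : ℕ => (n : ℝ) ^ κ) :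
    ∀ᶠ M : ℝ in atTop, Tendsto (fun n => μ {ω | ¬ SampleMomentsClose (designMatrix (x n ω)) (ε n ω)
      (C n) (M * √(Real.log n / n))}) atTop (𝓝 0) := by
  have hexponent : Tendsto (fun M : ℝ => M ^ 2 / (8 * V ^ 2)) atTop atTop :=
    (tendsto_pow_atTop two_ne_zero).atTop_div_const (by positivity)
  filter_upwards [hexponent.eventually_gt_atTop (2 * κ), eventually_ge_atTop 0] with M hM hM0
  set a := M ^ 2 / (8 * V ^ 2) with ha
  have hdecay : Tendsto (fun n : ℕ => 8 * (Fintype.card (ι n) : ℝ) ^ 2 * (n : ℝ) ^ (-a)) atTop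
      (𝓝 0) := by
    have hbound : (fun n : ℕ => 8 * (Fintype.card (ι n) : ℝ) ^ 2 * (n : ℝ) ^ (-a)) =O[atTop]
        fun n : ℕ => (n : ℝ) ^ (-(a - 2 * κ)) := by
      refine (((hp.pow 2).const_mul_left 8).mul (isBigO_refl _ _)).trans_eventuallyEq ?_
      filter_upwards [eventually_gt_atTop 0] with n hn
      rw [← Real.rpow_natCast, ← Real.rpow_mul (by positivity), ← Real.rpow_add (by positivity)]
      push_cast
      ring_nf
    exact hbound.trans_tendsto
      ((tendsto_rpow_neg_atTop (sub_pos.2 hM)).comp tendsto_natCast_atTop_atTop)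
  have hrate : Tendsto (fun n : ℕ => M * √(Real.log n / n)) atTop (𝓝 0) := by
    simpa using (tendsto_log_div_self_atTop.sqrt).const_mul M
  have hreal : Tendsto (fun n => μ.real {ω | ¬ SampleMomentsClose (designMatrix (x n ω)) (ε n ω)
      (C n) (M * √(Real.log n / n))}) atTop (𝓝 0) := by
    refine tendsto_of_tendsto_of_tendsto_of_le_of_le' tendsto_const_nhds hdecay
      (Eventually.of_forall fun _ => measureReal_nonneg) ?_
    filter_upwards [hrate.eventually_le_const hV0, eventually_gt_atTop 0, hC, hV]
      with n hn hn0 hCn hVn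
    refine ((hdata n).measureReal_not_sampleMomentsClose_le hCn hV0 hVn (by positivity)
      hn).trans_eq ?_
    rw [Real.rpow_def_of_pos (by positivity), mul_pow, Real.sq_sqrt (by positivity), ha]
    congr 2
    field_simp
  simpa [ofReal_measureReal] using ENNReal.tendsto_ofReal hreal

end Asymptotic

end GaussianSample

section PartialCovariance

variable {ι : Type*} [Fintype ι] [DecidableEq ι] {C : Matrix ι ι ℝ} {j : ι}

lemma mulVec_col_inv (hC : C.PosDef) : C *ᵥ C⁻¹.col j = Pi.single j 1 := by
  rw [← mulVec_single_one, mulVec_mulVec,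
    mul_nonsing_inv C ((Matrix.isUnit_iff_isUnit_det C).1 hC.isUnit), one_mulVec]

lemma sum_subtype_ne_eq_sum {f : ι → ℝ} (hf : f j = 0) : ∑ k : {k // k ≠ j}, f k = ∑ k, f k := by
  rw [Fintype.sum_eq_add_sum_subtype_ne f j, hf, zero_add]

/-- `b - (b_j / d_jj) D e_j`, where `D = C⁻¹`: the coefficients, vanishing at `j`, of the best
linear prediction of `b ⬝ᵥ X` from the covariates other than `X_j` when `Cov X = C`. -/
noncomputable def predictionCoeff (C : Matrix ι ι ℝ) (j : ι) (b : ι → ℝ) : ι → ℝ :=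
  b - (b j / C⁻¹ j j) • C⁻¹.col j

lemma predictionCoeff_self (hC : C.PosDef) (b : ι → ℝ) : predictionCoeff C j b j = 0 := by
  simp [predictionCoeff, div_mul_cancel₀ _ hC.inv.diag_pos.ne']

lemma mulVec_predictionCoeff (hC : C.PosDef) (b : ι → ℝ) :
    C *ᵥ predictionCoeff C j b = C *ᵥ b - Pi.single j (b j / C⁻¹ j j) := by
  rw [predictionCoeff, mulVec_sub, mulVec_smul, mulVec_col_inv hC, ← Pi.single_smul, smul_eq_mul,
    mul_one]

lemma inv_submatrix_ne_mulVec (hC : C.PosDef) (b : ι → ℝ) :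
    (C.submatrix Subtype.val Subtype.val)⁻¹ *ᵥ (fun k : {k // k ≠ j} => (C *ᵥ b) k) =
      fun k : {k // k ≠ j} => predictionCoeff C j b k := by
  have hR : (C.submatrix (Subtype.val : {k // k ≠ j} → ι) Subtype.val).PosDef :=
    hC.submatrix Subtype.val_injective
  have hnormal : (fun k : {k // k ≠ j} => (C *ᵥ b) k) = C.submatrix Subtype.val Subtype.val *ᵥ
      fun k : {k // k ≠ j} => predictionCoeff C j b k := by
    ext k
    have hk : (C *ᵥ predictionCoeff C j b) k = (C *ᵥ b) k := by
      simp [mulVec_predictionCoeff hC, k.2]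
    rw [← hk]
    exact (sum_subtype_ne_eq_sum (f := fun i => C k i * predictionCoeff C j b i)
      (by rw [predictionCoeff_self hC, mul_zero])).symm
  rw [hnormal, mulVec_mulVec, nonsing_inv_mul _ ((Matrix.isUnit_iff_isUnit_det _).1 hR.isUnit),
    one_mulVec]

lemma dotProduct_mulVec_sub_prediction (hC : C.PosDef) (a b : ι → ℝ) :
    a ⬝ᵥ C *ᵥ b - (fun k : {k // k ≠ j} => (C *ᵥ a) k) ⬝ᵥ
      ((C.submatrix Subtype.val Subtype.val)⁻¹ *ᵥ fun k : {k // k ≠ j} => (C *ᵥ b) k) =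
      a j * b j / C⁻¹ j j := by
  have hCt : Cᵀ = C := by simpa using hC.isHermitian.eq
  have hsum : (fun k : {k // k ≠ j} => (C *ᵥ a) k) ⬝ᵥ (fun k : {k // k ≠ j} =>
      predictionCoeff C j b k) = a ⬝ᵥ C *ᵥ predictionCoeff C j b := by
    rw [dotProduct_mulVec, ← mulVec_transpose, hCt]
    exact sum_subtype_ne_eq_sum (f := fun i => (C *ᵥ a) i * predictionCoeff C j b i)
      (by rw [predictionCoeff_self hC, mul_zero])
  rw [inv_submatrix_ne_mulVec hC, hsum, mulVec_predictionCoeff hC, dotProduct_sub,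
    dotProduct_single]
  ring

lemma partialCov_jointCov_some_some (hC : C.PosDef) (β : ι → ℝ) (σ : ℝ) (j : ι) :
    partialCov (jointCov C β σ) j (some j) (some j) = 1 / C⁻¹ j j := by
  have h := dotProduct_mulVec_sub_prediction (j := j) hC (Pi.single j 1) (Pi.single j 1)
  simp only [mulVec_single_one, single_one_dotProduct, Pi.single_eq_same, mul_one] at h
  rw [← h]
  have hrow (k : ι) : C j k = C k j := by simpa using hC.isHermitian.apply k j
  simp [partialCov, jointCov, Matrix.col, hrow, submatrix]

lemma partialCov_jointCov_none_some (hC : C.PosDef) (β : ι → ℝ) (σ : ℝ) (j : ι) :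
    partialCov (jointCov C β σ) j none (some j) = β j / C⁻¹ j j := by
  have h := dotProduct_mulVec_sub_prediction (j := j) hC β (Pi.single j 1)
  simp only [mulVec_single_one, Pi.single_eq_same, mul_one] at h
  rw [← h, ← mulVec_single_one, dotProduct_mulVec, dotProduct_single_one, ← mulVec_transpose,
    show Cᵀ = C by simpa using hC.isHermitian.eq]
  simp [partialCov, jointCov, submatrix]

lemma partialCov_jointCov_none_none (hC : C.PosDef) (β : ι → ℝ) (σ : ℝ) (j : ι) :
    partialCov (jointCov C β σ) j none none = σ ^ 2 + β j ^ 2 / C⁻¹ j j := by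
  rw [sq (β j), ← dotProduct_mulVec_sub_prediction hC β β, add_comm, sub_add_eq_add_sub]
  rfl

lemma spac_jointCov (hC : C.PosDef) (β : ι → ℝ) (σ : ℝ) (j : ι) :
    spac (jointCov C β σ) j = β j / √(C⁻¹ j j) := by
  have hd : 0 < C⁻¹ j j := hC.inv.diag_pos
  rcases eq_or_ne (β j) 0 with hβ | hβ
  · simp [spac, partialCorr, partialCov_jointCov_none_some hC, hβ]
  have hs : √(partialCov (jointCov C β σ) j none none) ≠ 0 := by
    rw [partialCov_jointCov_none_none hC]
    positivity
  calc spac (jointCov C β σ) j = β j / C⁻¹ j j / √(1 / C⁻¹ j j) := by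
        rw [spac, partialCorr, partialCov_jointCov_none_some hC, partialCov_jointCov_some_some hC,
          div_mul_eq_mul_div, mul_comm (√_), mul_div_mul_right _ _ hs]
    _ = β j / √(C⁻¹ j j) := by
        rw [one_div, Real.sqrt_inv, div_inv_eq_mul, div_mul, Real.div_sqrt]

lemma sign_spac_jointCov (hC : C.PosDef) (β : ι → ℝ) (σ : ℝ) (j : ι) :
    SignType.sign (spac (jointCov C β σ) j) = SignType.sign (β j) := by
  have hd : 0 < √(C⁻¹ j j) := Real.sqrt_pos.2 hC.inv.diag_pos
  rw [spac_jointCov hC, div_eq_mul_inv, sign_mul, sign_pos (inv_pos.2 hd), mul_one]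

lemma abs_spac_jointCov_le (hC : C.PosDef) (hd : 1 ≤ C⁻¹ j j) (β : ι → ℝ) (σ : ℝ) :
    |spac (jointCov C β σ) j| ≤ |β j| := by
  rw [spac_jointCov hC, abs_div, abs_of_nonneg (Real.sqrt_nonneg _)]
  exact div_le_self (abs_nonneg _) (Real.one_le_sqrt.2 hd)

end PartialCovariance

section Coercivity

/-- The quadratic form of `A` is at least `κ ‖v‖²`. Unlike `Matrix.PosSemidef (A - κ • 1)` this does
not ask `A` to be symmetric. -/
def CoerciveWith {ι : Type*} [Fintype ι] (κ : ℝ) (A : Matrix ι ι ℝ) : Prop :=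
  ∀ v, κ * (v ⬝ᵥ v) ≤ v ⬝ᵥ A *ᵥ v

variable {ι : Type*} [Fintype ι] {A : Matrix ι ι ℝ} {κ : ℝ}

lemma dotProduct_self_nonneg (v : ι → ℝ) : 0 ≤ v ⬝ᵥ v := by
  simpa using dotProduct_star_self_nonneg v

lemma dotProduct_self_le_card_mul_sq {w : ι → ℝ} {Z : ℝ} (hw : ∀ i, |w i| ≤ Z) :
    w ⬝ᵥ w ≤ Fintype.card ι * Z ^ 2 := by
  calc w ⬝ᵥ w ≤ ∑ _i : ι, Z ^ 2 := Finset.sum_le_sum fun i _ => by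
        rw [← sq, ← sq_abs]
        exact pow_le_pow_left₀ (abs_nonneg _) (hw i) 2
    _ = Fintype.card ι * Z ^ 2 := by simp

lemma abs_dotProduct_le_sum_abs_mul {a w : ι → ℝ} {Z : ℝ} (hw : ∀ i, |w i| ≤ Z) :
    |a ⬝ᵥ w| ≤ (∑ i, |a i|) * Z := by
  calc |a ⬝ᵥ w| ≤ ∑ i, |a i * w i| := Finset.abs_sum_le_sum_abs _ _
    _ ≤ ∑ i, |a i| * Z := Finset.sum_le_sum fun i _ => by
        rw [abs_mul]
        exact mul_le_mul_of_nonneg_left (hw i) (abs_nonneg _)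
    _ = (∑ i, |a i|) * Z := (Finset.sum_mul ..).symm

lemma sq_sum_abs_le_card_mul_dotProduct_self (v : ι → ℝ) :
    (∑ i, |v i|) ^ 2 ≤ Fintype.card ι * (v ⬝ᵥ v) := by
  have h := sq_sum_le_card_mul_sum_sq (s := Finset.univ) (f := fun i => |v i|)
  simpa only [sq_abs, Finset.card_univ, dotProduct, ← sq] using h

lemma inv_apply_self_le_of_mul_sq_le [DecidableEq ι] (hA : A.PosDef) (hκ : 0 < κ) {j : ι}
    (hj : ∀ v, κ * v j ^ 2 ≤ v ⬝ᵥ A *ᵥ v) : A⁻¹ j j ≤ 1 / κ := by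
  have h := hj (A⁻¹.col j)
  rw [mulVec_col_inv hA, dotProduct_single_one, col_apply, sq, ← mul_assoc] at h
  rw [le_div_iff₀ hκ, mul_comm]
  exact le_of_mul_le_mul_right (h.trans_eq (one_mul _).symm) hA.inv.diag_pos

namespace CoerciveWith

lemma sq_mul_dotProduct_self_le (hA : CoerciveWith κ A) (hκ : 0 ≤ κ) (v : ι → ℝ) :
    κ ^ 2 * (v ⬝ᵥ v) ≤ (A *ᵥ v) ⬝ᵥ (A *ᵥ v) := by
  have hsq : 0 ≤ (A *ᵥ v - κ • v) ⬝ᵥ (A *ᵥ v - κ • v) := dotProduct_self_nonneg _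
  simp only [sub_dotProduct, dotProduct_sub, smul_dotProduct, dotProduct_smul, smul_eq_mul,
    dotProduct_comm _ v] at hsq
  nlinarith [hA v]

lemma mul_abs_apply_le (hA : CoerciveWith κ A) (hκ : 0 ≤ κ) {v : ι → ℝ} {Z : ℝ}
    (hZ : ∀ i, |(A *ᵥ v) i| ≤ Z) (i : ι) : κ * |v i| ≤ √(Fintype.card ι) * Z := by
  have hZ0 : 0 ≤ Z := (abs_nonneg _).trans (hZ i)
  refine abs_le_of_sq_le_sq' ?_ (by positivity) |>.2
  calc (κ * |v i|) ^ 2 = κ ^ 2 * (v i * v i) := by rw [mul_pow, sq_abs, sq (v i)]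
    _ ≤ κ ^ 2 * (v ⬝ᵥ v) := by
        gcongr
        exact Finset.single_le_sum (f := fun j => v j * v j) (fun j _ => mul_self_nonneg _)
          (Finset.mem_univ i)
    _ ≤ Fintype.card ι * Z ^ 2 :=
        (hA.sq_mul_dotProduct_self_le hκ v).trans (dotProduct_self_le_card_mul_sq hZ)
    _ = (√(Fintype.card ι) * Z) ^ 2 := by rw [mul_pow, Real.sq_sqrt (by positivity)]

lemma mul_sum_abs_le (hA : CoerciveWith κ A) (hκ : 0 ≤ κ) {v : ι → ℝ} {Z : ℝ}
    (hZ : ∀ i, |(A *ᵥ v) i| ≤ Z) : κ * ∑ i, |v i| ≤ Fintype.card ι * Z := by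
  have hcardZ : 0 ≤ Fintype.card ι * Z :=
    (Finset.sum_nonneg fun i _ => abs_nonneg ((A *ᵥ v) i)).trans
      (by simpa using Finset.sum_le_card_nsmul Finset.univ _ Z fun i _ => hZ i)
  refine abs_le_of_sq_le_sq' ?_ hcardZ |>.2
  calc (κ * ∑ i, |v i|) ^ 2 = κ ^ 2 * (∑ i, |v i|) ^ 2 := mul_pow ..
    _ ≤ κ ^ 2 * (Fintype.card ι * (v ⬝ᵥ v)) := by
        gcongr
        exact sq_sum_abs_le_card_mul_dotProduct_self v
    _ = Fintype.card ι * (κ ^ 2 * (v ⬝ᵥ v)) := by ring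
    _ ≤ Fintype.card ι * (Fintype.card ι * Z ^ 2) := by
        refine mul_le_mul_of_nonneg_left ?_ (Nat.cast_nonneg _)
        exact (hA.sq_mul_dotProduct_self_le hκ v).trans (dotProduct_self_le_card_mul_sq hZ)
    _ = (Fintype.card ι * Z) ^ 2 := by ring

lemma eq_zero_of_mulVec_eq_zero (hA : CoerciveWith κ A) (hκ : 0 < κ) {v : ι → ℝ}
    (hv : A *ᵥ v = 0) : v = 0 := by
  have h := hA v
  rw [hv, dotProduct_zero] at h
  exact dotProduct_self_eq_zero.1
    (le_antisymm (nonpos_of_mul_nonpos_right h hκ) (dotProduct_self_nonneg v))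

lemma mulVec_surjective (hA : CoerciveWith κ A) (hκ : 0 < κ) : Function.Surjective A.mulVec := by
  classical
  rw [Matrix.mulVec_surjective_iff_isUnit, ← Matrix.mulVec_injective_iff_isUnit]
  intro v w hvw
  refine sub_eq_zero.1 (hA.eq_zero_of_mulVec_eq_zero hκ ?_)
  rw [mulVec_sub]
  exact sub_eq_zero.2 hvw

lemma of_abs_sub_le (hA : CoerciveWith κ A) {A' : Matrix ι ι ℝ} {T : ℝ} (hT : 0 ≤ T)
    (hAA' : ∀ k l, |A' k l - A k l| ≤ T) : CoerciveWith (κ - Fintype.card ι * T) A' := by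
  intro v
  have hentry k : |((A' - A) *ᵥ v) k| ≤ T * ∑ l, |v l| := by
    rw [mulVec, dotProduct_comm, mul_comm]
    exact abs_dotProduct_le_sum_abs_mul (hAA' k)
  have hpert : |v ⬝ᵥ (A' - A) *ᵥ v| ≤ T * (Fintype.card ι * (v ⬝ᵥ v)) :=
    calc |v ⬝ᵥ (A' - A) *ᵥ v| ≤ (∑ k, |v k|) * (T * ∑ l, |v l|) :=
          abs_dotProduct_le_sum_abs_mul hentry
      _ = T * (∑ k, |v k|) ^ 2 := by ring
      _ ≤ T * (Fintype.card ι * (v ⬝ᵥ v)) := by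
          gcongr
          exact sq_sum_abs_le_card_mul_dotProduct_self v
  rw [sub_mulVec, dotProduct_sub] at hpert
  linarith [hA v, neg_abs_le (v ⬝ᵥ A' *ᵥ v - v ⬝ᵥ A *ᵥ v)]

lemma mono (hA : CoerciveWith κ A) {κ' : ℝ} (h : κ' ≤ κ) : CoerciveWith κ' A := fun v =>
  (mul_le_mul_of_nonneg_right h (dotProduct_self_nonneg v)).trans (hA v)

lemma smul (hA : CoerciveWith κ A) {c : ℝ} (hc : 0 ≤ c) :
    CoerciveWith (c * κ) (c • A) := fun v => by
  rw [smul_mulVec, dotProduct_smul, smul_eq_mul, mul_assoc]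
  exact mul_le_mul_of_nonneg_left (hA v) hc

lemma toBlocks₁₁ {ι' : Type*} [Fintype ι'] {A : Matrix (ι ⊕ ι') (ι ⊕ ι') ℝ}
    (hA : CoerciveWith κ A) : CoerciveWith κ A.toBlocks₁₁ := fun v => by
  simpa [dotProduct, mulVec, Matrix.toBlocks₁₁] using hA (Sum.elim v 0)

lemma inv_apply_self_le [DecidableEq ι] (hA : CoerciveWith κ A) (hκ : 0 < κ) (hpos : A.PosDef)
    (j : ι) : A⁻¹ j j ≤ 1 / κ := by
  refine inv_apply_self_le_of_mul_sq_le hpos hκ fun v => (hA v).trans' ?_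
  rw [sq]
  exact mul_le_mul_of_nonneg_left (Finset.single_le_sum (f := fun i => v i * v i)
    (fun i _ => mul_self_nonneg _) (Finset.mem_univ j)) hκ.le

end CoerciveWith

/-- The matrix inverse is a maximum of concave quadratics: `v = C⁻¹ e_j` gives equality. -/
lemma two_mul_sub_dotProduct_mulVec_le_inv [DecidableEq ι] {C : Matrix ι ι ℝ} (hC : C.PosDef)
    (j : ι) (v : ι → ℝ) : 2 * v j - v ⬝ᵥ C *ᵥ v ≤ C⁻¹ j j := by
  have hsymm : C⁻¹.col j ⬝ᵥ C *ᵥ v = v j := by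
    rw [dotProduct_mulVec, ← mulVec_transpose, show Cᵀ = C by simpa using hC.isHermitian.eq,
      mulVec_col_inv hC, single_one_dotProduct]
  have h := hC.posSemidef.dotProduct_mulVec_nonneg (v - C⁻¹.col j)
  simp only [star_trivial, mulVec_sub, mulVec_col_inv hC, sub_dotProduct, dotProduct_sub,
    dotProduct_single_one, hsymm, Pi.sub_apply] at h
  linarith [show C⁻¹.col j j = C⁻¹ j j from rfl]

lemma one_le_inv_apply_self [DecidableEq ι] {C : Matrix ι ι ℝ} (hC : C.PosDef) {j : ι}
    (hj : C j j = 1) : 1 ≤ C⁻¹ j j := by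
  have h := two_mul_sub_dotProduct_mulVec_le_inv hC j (Pi.single j 1)
  simp only [mulVec_single_one, single_one_dotProduct, Pi.single_eq_same, col_apply, hj] at h
  linarith

end Coercivity

section WeightedLasso

variable {m ι : Type*} [Fintype m] [Fintype ι]

/-- The weighted Lasso objective `½ ‖y - X h‖² + ∑ p_j |h_j|`, to which the SPAC-Lasso objective
reduces (`spacLassoLoss_eq_lassoLoss`). -/
noncomputable def lassoLoss (X : Matrix m ι ℝ) (y : m → ℝ) (p h : ι → ℝ) : ℝ :=
  1 / 2 * ((y - X *ᵥ h) ⬝ᵥ (y - X *ᵥ h)) + ∑ j, p j * |h j|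

/-- `h` is a weighted Lasso estimate: a global minimizer of the weighted Lasso objective. -/
def IsLassoMin (X : Matrix m ι ℝ) (y : m → ℝ) (p h : ι → ℝ) : Prop :=
  ∀ h', lassoLoss X y p h ≤ lassoLoss X y p h'

lemma lassoLoss_sub (X : Matrix m ι ℝ) (y : m → ℝ) (p h h₀ : ι → ℝ) :
    lassoLoss X y p h - lassoLoss X y p h₀ =
      1 / 2 * ((X *ᵥ (h - h₀)) ⬝ᵥ (X *ᵥ (h - h₀))) +
      ∑ j, (p j * (|h j| - |h₀ j|) - (Xᵀ *ᵥ (y - X *ᵥ h₀)) j * (h j - h₀ j)) := by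
  have hresidual : y - X *ᵥ h = (y - X *ᵥ h₀) - X *ᵥ (h - h₀) := by rw [mulVec_sub]; abel
  have hcross : ∑ j, (Xᵀ *ᵥ (y - X *ᵥ h₀)) j * (h j - h₀ j) =
      (y - X *ᵥ h₀) ⬝ᵥ X *ᵥ (h - h₀) := by
    rw [dotProduct_mulVec, ← mulVec_transpose]
    rfl
  rw [Finset.sum_sub_distrib, hcross, lassoLoss, lassoLoss, hresidual]
  generalize y - X *ᵥ h₀ = u
  simp only [mul_sub, Finset.sum_sub_distrib]
  rw [sub_dotProduct, dotProduct_sub, dotProduct_sub, dotProduct_comm (X *ᵥ (h - h₀)) u]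
  ring

lemma sign_mul_le_abs (a b : ℝ) : (SignType.sign a : ℝ) * b ≤ |b| := by
  refine (le_abs_self _).trans ?_
  rw [abs_mul]
  refine mul_le_of_le_one_left (abs_nonneg b) ?_
  cases SignType.sign a <;> simp

/-- The Karush–Kuhn–Tucker conditions for the weighted Lasso, strict off `S`. -/
structure IsStrictKKT (X : Matrix m ι ℝ) (y : m → ℝ) (p h₀ : ι → ℝ) (S : Set ι) : Prop where
  weight_nonneg : ∀ j ∈ S, 0 ≤ p j
  stationary : ∀ j ∈ S, (Xᵀ *ᵥ (y - X *ᵥ h₀)) j = p j * SignType.sign (h₀ j)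
  eq_zero : ∀ j ∉ S, h₀ j = 0
  abs_lt : ∀ j ∉ S, |(Xᵀ *ᵥ (y - X *ᵥ h₀)) j| < p j

namespace IsStrictKKT

variable {X : Matrix m ι ℝ} {y : m → ℝ} {p h₀ : ι → ℝ} {S : Set ι}

lemma mul_sub_abs_le (hkkt : IsStrictKKT X y p h₀ S) {j : ι} (hj : j ∉ S) (h : ι → ℝ) :
    (p j - |(Xᵀ *ᵥ (y - X *ᵥ h₀)) j|) * |h j| ≤
      p j * (|h j| - |h₀ j|) - (Xᵀ *ᵥ (y - X *ᵥ h₀)) j * (h j - h₀ j) := by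
  rw [hkkt.eq_zero j hj, abs_zero, sub_zero, sub_zero, sub_mul, ← abs_mul]
  exact sub_le_sub_left (le_abs_self _) _

lemma penalty_sub_nonneg (hkkt : IsStrictKKT X y p h₀ S) (h : ι → ℝ) (j : ι) :
    0 ≤ p j * (|h j| - |h₀ j|) - (Xᵀ *ᵥ (y - X *ᵥ h₀)) j * (h j - h₀ j) := by
  by_cases hj : j ∈ S
  · calc 0 ≤ p j * (|h j| - SignType.sign (h₀ j) * h j) :=
          mul_nonneg (hkkt.weight_nonneg j hj) (sub_nonneg.2 (sign_mul_le_abs _ _))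
      _ = p j * (|h j| - |h₀ j|) - (Xᵀ *ᵥ (y - X *ᵥ h₀)) j * (h j - h₀ j) := by
          rw [hkkt.stationary j hj, ← sign_mul_self (h₀ j)]
          ring
  · exact (mul_nonneg (sub_pos.2 (hkkt.abs_lt j hj)).le (abs_nonneg _)).trans
      (hkkt.mul_sub_abs_le hj h)

lemma isLassoMin (hkkt : IsStrictKKT X y p h₀ S) : IsLassoMin X y p h₀ := fun h => by
  have hpenalty := Finset.sum_nonneg fun j (_ : j ∈ Finset.univ) => hkkt.penalty_sub_nonneg h j
  linarith [lassoLoss_sub X y p h h₀, dotProduct_self_nonneg (X *ᵥ (h - h₀))]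

lemma isLassoMin_iff (hkkt : IsStrictKKT X y p h₀ S)
    (hinj : ∀ v : ι → ℝ, (∀ j ∉ S, v j = 0) → X *ᵥ v = 0 → v = 0) (h : ι → ℝ) :
    IsLassoMin X y p h ↔ h = h₀ := by
  refine ⟨fun hmin => ?_, fun heq => heq ▸ hkkt.isLassoMin⟩
  have hloss := lassoLoss_sub X y p h h₀
  have hpenalty := Finset.sum_nonneg fun j (_ : j ∈ Finset.univ) => hkkt.penalty_sub_nonneg h j
  have hfit := dotProduct_self_nonneg (X *ᵥ (h - h₀))
  have hpenalty0 := (Finset.sum_eq_zero_iff_of_nonneg fun j _ => hkkt.penalty_sub_nonneg h j).1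
    (le_antisymm (by linarith [hmin h₀]) hpenalty)
  have hfit0 : X *ᵥ (h - h₀) = 0 := dotProduct_self_eq_zero.1 (by linarith [hmin h₀])
  refine sub_eq_zero.1 (hinj _ (fun j hj => ?_) hfit0)
  have hle := (hkkt.mul_sub_abs_le hj h).trans_eq (hpenalty0 j (Finset.mem_univ j))
  have habs : |h j| = 0 := le_antisymm
    (nonpos_of_mul_nonpos_right hle (sub_pos.2 (hkkt.abs_lt j hj))) (abs_nonneg _)
  rw [Pi.sub_apply, abs_eq_zero.1 habs, hkkt.eq_zero j hj, sub_zero]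

end IsStrictKKT

lemma spacLassoLoss_eq_lassoLoss {n : ℕ} (x : Fin n → EuclideanSpace ℝ ι) (y : Fin n → ℝ)
    {d : ι → ℝ} (hd : ∀ j, 0 ≤ d j) (lam : ℝ) (g : ι → ℝ) :
    spacLassoLoss x y d lam g =
      lassoLoss (designMatrix x) y (fun j => lam * √(d j)) (fun j => √(d j) * g j) := by
  have hpenalty j : lam * (d j * |g j|) = lam * √(d j) * |√(d j) * g j| := by
    rw [abs_mul, abs_of_nonneg (Real.sqrt_nonneg _)]
    linear_combination (-lam * |g j|) * Real.mul_self_sqrt (hd j)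
  simp only [spacLassoLoss, lassoLoss, Finset.mul_sum, hpenalty, dotProduct, designMatrix, mulVec,
    of_apply, Pi.sub_apply, mul_assoc, sq]

lemma isSpacLasso_iff_isLassoMin {n : ℕ} (x : Fin n → EuclideanSpace ℝ ι) (y : Fin n → ℝ)
    {d : ι → ℝ} (hd : ∀ j, 0 < d j) (lam : ℝ) (g : ι → ℝ) :
    IsSpacLasso x y d lam g ↔
      IsLassoMin (designMatrix x) y (fun j => lam * √(d j)) (fun j => √(d j) * g j) := by
  simp only [IsSpacLasso, spacLassoLoss_eq_lassoLoss x y (fun j => (hd j).le) lam]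
  refine ⟨fun hg h => ?_, fun hg h => hg _⟩
  have hscale : (fun j => √(d j) * (h j / √(d j))) = h := by
    ext j
    exact mul_div_cancel₀ _ (Real.sqrt_pos.2 (hd j)).ne'
  simpa only [hscale] using hg fun j => h j / √(d j)

end WeightedLasso

section SignRecovery

lemma sign_add_eq_of_abs_lt {a b : ℝ} (h : |b| < |a|) :
    SignType.sign (a + b) = SignType.sign a := by
  rcases lt_trichotomy a 0 with ha | rfl | ha
  · rw [abs_of_neg ha] at h
    rw [sign_neg ha, sign_neg (by linarith [le_abs_self b])]
  · simp [(abs_nonneg b).not_gt] at h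
  · rw [abs_of_pos ha] at h
    rw [sign_pos ha, sign_pos (by linarith [neg_abs_le b])]

variable {m ι ι' : Type*} [Fintype m] [Fintype ι] {S : Matrix (ι ⊕ ι') (ι ⊕ ι') ℝ}
  {R : Matrix ι' ι ℝ} {T B : ℝ}

/-- The large cross moment `G₂₁ v` is controlled by `G₁₁ v`, because `G₂₁ - R G₁₁` vanishes when `G`
is replaced by its target `S`. -/
lemma abs_toBlocks₂₁_mulVec_sub_le {G : Matrix (ι ⊕ ι') (ι ⊕ ι') ℝ}
    (hS : S.toBlocks₂₁ = R * S.toBlocks₁₁) (hG : ∀ k l, |G k l - S k l| ≤ T) (hT : 0 ≤ T)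
    (v : ι → ℝ) {j : ι'} (hR : ∑ i, |R j i| ≤ B) :
    |(G.toBlocks₂₁ *ᵥ v) j - R j ⬝ᵥ G.toBlocks₁₁ *ᵥ v| ≤ T * (1 + B) * ∑ i, |v i| := by
  have hrow i : |(G.toBlocks₂₁ - R * G.toBlocks₁₁) j i| ≤ T * (1 + B) := by
    have hdecomp : (G.toBlocks₂₁ - R * G.toBlocks₁₁) j i = (G (.inr j) (.inl i) -
        S (.inr j) (.inl i)) - R j ⬝ᵥ fun k => G (.inl k) (.inl i) - S (.inl k) (.inl i) := by
      have hSji : S (.inr j) (.inl i) = R j ⬝ᵥ fun k => S (.inl k) (.inl i) :=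
        congrFun (congrFun hS j) i
      rw [hSji, ← Pi.sub_def, dotProduct_sub]
      simp [mul_apply, dotProduct, toBlocks₁₁, toBlocks₂₁]
    calc _ ≤ |G (.inr j) (.inl i) - S (.inr j) (.inl i)| +
          |R j ⬝ᵥ fun k => G (.inl k) (.inl i) - S (.inl k) (.inl i)| := by
          rw [hdecomp]
          exact abs_sub _ _
      _ ≤ T + (∑ k, |R j k|) * T :=
          add_le_add (hG _ _) (abs_dotProduct_le_sum_abs_mul fun k => hG _ _)
      _ ≤ T * (1 + B) := by nlinarith
  have hvec : (G.toBlocks₂₁ *ᵥ v) j - R j ⬝ᵥ G.toBlocks₁₁ *ᵥ v =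
      v ⬝ᵥ (G.toBlocks₂₁ - R * G.toBlocks₁₁) j := by
    rw [dotProduct_comm v]
    change _ = ((G.toBlocks₂₁ - R * G.toBlocks₁₁) *ᵥ v) j
    rw [sub_mulVec, ← mulVec_mulVec]
    rfl
  rw [hvec, mul_comm]
  exact abs_dotProduct_le_sum_abs_mul hrow

lemma abs_sub_toBlocks₂₁_mulVec_le {G : Matrix (ι ⊕ ι') (ι ⊕ ι') ℝ}
    (hS : S.toBlocks₂₁ = R * S.toBlocks₁₁) (hG : ∀ k l, |G k l - S k l| ≤ T) {ξ : ι ⊕ ι' → ℝ}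
    (hξ : ∀ k, |ξ k| ≤ T) {s v : ι → ℝ} (hv : G.toBlocks₁₁ *ᵥ v = (fun i => ξ (.inl i)) - s)
    {j : ι'} (hR : ∑ i, |R j i| ≤ B) :
    |ξ (.inr j) - (G.toBlocks₂₁ *ᵥ v) j| ≤
      T + B * T + |R j ⬝ᵥ s| + T * (1 + B) * ∑ i, |v i| := by
  have hT : 0 ≤ T := (abs_nonneg _).trans (hξ (.inr j))
  have hcross := abs_toBlocks₂₁_mulVec_sub_le hS hG hT v hR
  have hRξ : |R j ⬝ᵥ fun i => ξ (.inl i)| ≤ B * T :=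
    (abs_dotProduct_le_sum_abs_mul fun i => hξ _).trans (mul_le_mul_of_nonneg_right hR hT)
  rw [hv, dotProduct_sub] at hcross
  have hξj := hξ (.inr j)
  rw [abs_le] at hcross hRξ hξj ⊢
  constructor <;> linarith [le_abs_self (R j ⬝ᵥ s), neg_abs_le (R j ⬝ᵥ s)]

variable [Fintype ι'] {X : Matrix m (ι ⊕ ι') ℝ} {e : m → ℝ} {p : ι ⊕ ι' → ℝ} {b : ι → ℝ} {P κ : ℝ}

lemma mulVec_sumElim_zero (A : Matrix (ι ⊕ ι') (ι ⊕ ι') ℝ) (v : ι → ℝ) :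
    A *ᵥ Sum.elim v 0 = Sum.elim (A.toBlocks₁₁ *ᵥ v) (A.toBlocks₂₁ *ᵥ v) := by
  ext (i | j) <;> simp [mulVec, dotProduct, toBlocks₁₁, toBlocks₂₁]

lemma score_add_sumElim_zero (X : Matrix m (ι ⊕ ι') ℝ) (e : m → ℝ) (b v : ι → ℝ) :
    Xᵀ *ᵥ ((X *ᵥ Sum.elim b 0 + e) - X *ᵥ Sum.elim (b + v) 0) = Xᵀ *ᵥ e -
      Sum.elim ((Xᵀ * X).toBlocks₁₁ *ᵥ v) ((Xᵀ * X).toBlocks₂₁ *ᵥ v) := by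
  have hsplit : Sum.elim (b + v) (0 : ι' → ℝ) = Sum.elim b 0 + Sum.elim v 0 := by
    ext (i | j) <;> simp
  rw [← mulVec_sumElim_zero, ← mulVec_mulVec, ← mulVec_sub, hsplit, mulVec_add]
  congr 1
  abel

lemma CoerciveWith.eq_zero_of_mulVec_eq_zero_of_support
    (hcoer : CoerciveWith κ (Xᵀ * X).toBlocks₁₁) (hκ : 0 < κ) {v : ι ⊕ ι' → ℝ}
    (hsupp : ∀ j ∉ Set.range Sum.inl, v j = 0) (hXv : X *ᵥ v = 0) : v = 0 := by
  have hv : v = Sum.elim (v ∘ Sum.inl) 0 := by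
    ext (i | j)
    · rfl
    · exact hsupp _ (by simp)
  have hblock : (Xᵀ * X).toBlocks₁₁ *ᵥ (v ∘ Sum.inl) = 0 := by
    have hgram : (Xᵀ * X) *ᵥ v = 0 := by rw [← mulVec_mulVec, hXv, mulVec_zero]
    rw [hv, mulVec_sumElim_zero] at hgram
    ext i
    exact congrFun hgram (.inl i)
  rw [hv, hcoer.eq_zero_of_mulVec_eq_zero hκ hblock, Sum.elim_zero_zero]

theorem exists_isLassoMin_iff_eq_and_sign_eq (hS : S.toBlocks₂₁ = R * S.toBlocks₁₁)
    (hgram : ∀ k l, |(Xᵀ * X) k l - S k l| ≤ T) (hnoise : ∀ k, |(Xᵀ *ᵥ e) k| ≤ T)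
    (hκ : 0 < κ) (hcoer : CoerciveWith κ (Xᵀ * X).toBlocks₁₁) (hR : ∀ j, ∑ i, |R j i| ≤ B)
    (hp₀ : ∀ i, 0 ≤ p (.inl i)) (hP : ∀ i, p (.inl i) ≤ P)
    (hsignal : ∀ i, √(Fintype.card ι) * (T + P) < κ * |b i|)
    (hdual : ∀ j, T + B * T + |R j ⬝ᵥ fun i => p (.inl i) * SignType.sign (b i)| +
      T * (1 + B) * (Fintype.card ι * (T + P) / κ) < p (.inr j)) :
    ∃ h₀ : ι ⊕ ι' → ℝ, (∀ h, IsLassoMin X (X *ᵥ Sum.elim b 0 + e) p h ↔ h = h₀) ∧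
      ∀ k, SignType.sign (h₀ k) = SignType.sign (Sum.elim b 0 k) := by
  set G := Xᵀ * X with hG
  set s : ι → ℝ := fun i => p (.inl i) * SignType.sign (b i) with hs
  set z : ι → ℝ := (fun i => (Xᵀ *ᵥ e) (.inl i)) - s with hz
  obtain ⟨v, hv⟩ := hcoer.mulVec_surjective hκ z
  have hzle i : |z i| ≤ T + P := by
    have hsle : |s i| ≤ P := by
      rw [hs, abs_mul, abs_of_nonneg (hp₀ i)]
      refine (mul_le_of_le_one_right (hp₀ i) ?_).trans (hP i)
      cases SignType.sign (b i) <;> simp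
    exact (abs_sub _ _).trans (add_le_add (hnoise _) hsle)
  have hGv i : |(G.toBlocks₁₁ *ᵥ v) i| ≤ T + P := by rw [hv]; exact hzle i
  have hsign i : SignType.sign (b i + v i) = SignType.sign (b i) :=
    sign_add_eq_of_abs_lt (lt_of_mul_lt_mul_left
      ((hcoer.mul_abs_apply_le hκ.le hGv i).trans_lt (hsignal i)) hκ.le)
  have hdualv j : |(Xᵀ *ᵥ e) (.inr j) - (G.toBlocks₂₁ *ᵥ v) j| < p (.inr j) := by
    have hT : 0 ≤ T := (abs_nonneg _).trans (hnoise (.inr j))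
    have hB : 0 ≤ B := (Finset.sum_nonneg fun i _ => abs_nonneg (R j i)).trans (hR j)
    have hv1 : ∑ i, |v i| ≤ Fintype.card ι * (T + P) / κ := by
      rw [le_div_iff₀' hκ]
      exact hcoer.mul_sum_abs_le hκ.le hGv
    exact ((abs_sub_toBlocks₂₁_mulVec_le hS hgram hnoise hv (hR j)).trans (by gcongr)).trans_lt
      (hdual j)
  have hkkt : IsStrictKKT X (X *ᵥ Sum.elim b 0 + e) p (Sum.elim (b + v) 0) (Set.range Sum.inl) := by
    constructor
    · rintro _ ⟨i, rfl⟩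
      exact hp₀ i
    · rintro _ ⟨i, rfl⟩
      simp [score_add_sumElim_zero, ← hG, hv, hz, hs, hsign]
    all_goals rintro (i | j) hk
    · simp at hk
    · rfl
    · simp at hk
    · simpa [score_add_sumElim_zero] using hdualv j
  exact ⟨_, hkkt.isLassoMin_iff fun _ => hcoer.eq_zero_of_mulVec_eq_zero_of_support hκ,
    Sum.rec hsign fun _ => rfl⟩

end SignRecovery

section SpacLasso

lemma abs_sqrt_sub_sqrt_le {u v : ℝ} (hu : 0 ≤ u) (hv : 1 ≤ v) : |√u - √v| ≤ |u - v| := by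
  have hfactor : u - v = (√u - √v) * (√u + √v) := by
    rw [mul_comm, ← sq_sub_sq, Real.sq_sqrt hu, Real.sq_sqrt (by linarith)]
  have hone : 1 ≤ |√u + √v| := by
    rw [abs_of_nonneg (by positivity)]
    linarith [Real.one_le_sqrt.2 hv, Real.sqrt_nonneg u]
  rw [hfactor, abs_mul]
  exact le_mul_of_one_le_right (abs_nonneg _) hone

lemma exists_isSpacLasso_and_sign_eq {ι : Type*} [Fintype ι] {n : ℕ}
    {x : Fin n → EuclideanSpace ℝ ι} {y : Fin n → ℝ} {d : ι → ℝ} (hd : ∀ j, 0 < d j) {lam : ℝ}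
    {h₀ b : ι → ℝ}
    (hmin : ∀ h, IsLassoMin (designMatrix x) y (fun j => lam * √(d j)) h ↔ h = h₀)
    (hsign : ∀ j, SignType.sign (h₀ j) = SignType.sign (b j)) :
    (∃ g, IsSpacLasso x y d lam g) ∧
      ∀ g, IsSpacLasso x y d lam g → ∀ j, SignType.sign (g j) = SignType.sign (b j) := by
  have hsqrt j : 0 < √(d j) := Real.sqrt_pos.2 (hd j)
  refine ⟨⟨fun j => h₀ j / √(d j), (isSpacLasso_iff_isLassoMin x y hd lam _).2 ((hmin _).2 ?_)⟩,
    fun g hg j => ?_⟩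
  · ext j
    exact mul_div_cancel₀ _ (hsqrt j).ne'
  · have hgj := congrFun ((hmin _).1 ((isSpacLasso_iff_isLassoMin x y hd lam g).1 hg)) j
    rw [← hsign j, ← hgj, sign_mul, sign_pos (hsqrt j), one_mul]

lemma transformedIrrepVector_apply {q r : ℕ} {C : Matrix (Fin q ⊕ Fin r) (Fin q ⊕ Fin r) ℝ}
    (hC : C.PosDef) (γ : Fin q ⊕ Fin r → ℝ) (j : Fin r) :
    transformedIrrepVector C γ j = (∑ i, (C.toBlocks₂₁ * C.toBlocks₁₁⁻¹) j i *
      (√(C⁻¹ (.inl i) (.inl i)) * SignType.sign (γ (.inl i)))) / √(C⁻¹ (.inr j) (.inr j)) := by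
  have hinv : (diagonal fun i : Fin q => √(1 / C⁻¹ (.inl i) (.inl i)))⁻¹ =
      diagonal fun i : Fin q => √(C⁻¹ (.inl i) (.inl i)) := by
    apply inv_eq_right_inv
    rw [diagonal_mul_diagonal, ← diagonal_one]
    congr 1
    ext i
    have hd : 0 < C⁻¹ (.inl i) (.inl i) := hC.inv.diag_pos
    rw [← Real.sqrt_mul (by positivity), one_div_mul_cancel hd.ne', Real.sqrt_one]
  rw [transformedIrrepVector, hinv, Matrix.mul_assoc (diagonal _), ← mulVec_mulVec,
    ← mulVec_mulVec, mulVec_diagonal, one_div, Real.sqrt_inv, inv_mul_eq_div]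
  simp only [mulVec, dotProduct, diagonal_apply, ite_mul, zero_mul, Finset.sum_ite_eq,
    Finset.mem_univ, if_true]

lemma toBlocks₂₁_smul_eq_mul {ι ι' : Type*} [Fintype ι] [DecidableEq ι]
    {C : Matrix (ι ⊕ ι') (ι ⊕ ι') ℝ} (hC : C.PosDef) (a : ℝ) :
    (a • C).toBlocks₂₁ = C.toBlocks₂₁ * C.toBlocks₁₁⁻¹ * (a • C).toBlocks₁₁ := by
  have h₁₁ : C.toBlocks₁₁.PosDef := hC.submatrix Sum.inl_injective
  change a • C.toBlocks₂₁ = C.toBlocks₂₁ * C.toBlocks₁₁⁻¹ * a • C.toBlocks₁₁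
  rw [Matrix.mul_smul, Matrix.mul_assoc,
    nonsing_inv_mul _ ((Matrix.isUnit_iff_isUnit_det _).1 h₁₁.isUnit), Matrix.mul_one]

/-- Smallness of the four ratios on which the deterministic analysis depends, where `q` is the
number of relevant covariates, `t` the error in the sample moments and in `d̂`, and `l` a lower
bound on the signals. The last two compare noise with penalty and the shrinkage bias with the
signals. -/
structure RatesWithin (c : ℝ) (q n : ℕ) (t lam l : ℝ) : Prop where
  error_le : t ≤ c
  dim_mul_error_le : q * t ≤ c
  noise_le : n * t ≤ c * lam
  bias_le : √q * lam ≤ c * (n * l)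

/-- Determines the admissible constants `c` in `RatesWithin`: `c * rateFactor κ B < min η 1`
suffices if the covariance matrix is coercive with constant `κ`, `C₂₁ C₁₁⁻¹` has `ℓ¹` row norms at
most `B`, and the transformed irrepresentable condition holds with margin `η`. -/
noncomputable def rateFactor (κ B : ℝ) : ℝ := 2 * (1 + B) * (1 + (2 + 1 / κ) / κ)

variable {q r n : ℕ} {C : Matrix (Fin q ⊕ Fin r) (Fin q ⊕ Fin r) ℝ} {κ B c t lam l η : ℝ}

lemma two_add_two_mul_le_rateFactor (hκ : 0 < κ) (hB : 0 ≤ B) :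
    2 + 2 * ((2 + 1 / κ) / κ) ≤ rateFactor κ B := by
  have ha : 0 ≤ (2 + 1 / κ) / κ := by positivity
  rw [rateFactor]
  nlinarith

lemma lt_one_of_mul_rateFactor_lt_one (hκ : 0 < κ) (hB : 0 ≤ B) (hc : c * rateFactor κ B < 1) :
    c < 1 := by
  have hfactor := two_add_two_mul_le_rateFactor hκ hB
  nlinarith [show 0 ≤ (2 + 1 / κ) / κ by positivity]

lemma le_div_four_of_mul_rateFactor_le_one (hc0 : 0 ≤ c) (hκ : 0 < κ) (hB : 0 ≤ B)
    (hc : c * rateFactor κ B ≤ 1) : c ≤ κ / 4 := by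
  have hfactor : 4 / κ ≤ rateFactor κ B := by
    refine le_trans ?_ (two_add_two_mul_le_rateFactor hκ hB)
    have hinv : 0 ≤ 1 / κ := by positivity
    calc 4 / κ = 2 * (2 / κ) := by ring
      _ ≤ 2 + 2 * ((2 + 1 / κ) / κ) := by
          have : 2 / κ ≤ (2 + 1 / κ) / κ := by gcongr; linarith
          linarith
  have h := (mul_le_mul_of_nonneg_left hfactor hc0).trans hc
  rw [mul_div_assoc', div_le_one hκ] at h
  linarith

namespace RatesWithin

lemma noise_add_penalty_le (h : RatesWithin c q n t lam l) (hc : c ≤ 1) (hκ : 0 < κ)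
    (hlam : 0 ≤ lam) : n * t + lam * (1 / κ + 1) ≤ lam * (κ * ((2 + 1 / κ) / κ)) := by
  rw [mul_div_cancel₀ _ hκ.ne']
  linarith [h.noise_le, mul_le_mul_of_nonneg_right hc hlam]

lemma signal_lt (h : RatesWithin c q n t lam l) (hc0 : 0 ≤ c) (hκ : 0 < κ) (hB : 0 ≤ B)
    (hc : c * rateFactor κ B < 1) (hlam : 0 ≤ lam) (hn : 0 < n) (hl : 0 < l) :
    √q * (n * t + lam * (1 / κ + 1)) < n * κ / 2 * l := by
  have hfactor := two_add_two_mul_le_rateFactor hκ hB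
  set a := (2 + 1 / κ) / κ
  have ha0 : 0 ≤ a := by positivity
  have hca : c * (2 + 2 * a) < 1 := (mul_le_mul_of_nonneg_left hfactor hc0).trans_lt hc
  calc √q * (n * t + lam * (1 / κ + 1)) ≤ √q * (lam * (κ * a)) := by
        gcongr
        exact h.noise_add_penalty_le (by nlinarith) hκ hlam
    _ = √q * lam * (κ * a) := by ring
    _ ≤ c * (n * l) * (κ * a) := mul_le_mul_of_nonneg_right h.bias_le (by positivity)
    _ = n * κ * l * (c * a) := by ring
    _ < n * κ * l * (1 / 2) := by
        gcongr
        linarith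
    _ = n * κ / 2 * l := by ring

lemma dual_lt (h : RatesWithin c q n t lam l) (hc0 : 0 ≤ c) (hκ : 0 < κ) (hB : 0 ≤ B)
    (hc : c * rateFactor κ B < 1) (hη : c * rateFactor κ B < η) (ht : 0 ≤ t) (hlam : 0 < lam)
    (hn : 0 < n) {v : ℝ} (hv : 1 ≤ v) :
    n * t + B * (n * t) + lam * ((1 - η) * v + B * t) +
      n * t * (1 + B) * (q * (n * t + lam * (1 / κ + 1)) / (n * κ / 2)) < lam * (v - t) := by
  have hfactor := two_add_two_mul_le_rateFactor hκ hB
  have hη0 : 0 < η := lt_of_le_of_lt (mul_nonneg hc0 (by rw [rateFactor]; positivity)) hη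
  have hpenalty := h.noise_add_penalty_le (κ := κ)
    (by nlinarith [show 0 ≤ (2 + 1 / κ) / κ by positivity]) hκ hlam.le
  set a := (2 + 1 / κ) / κ with ha
  have ha0 : 0 ≤ a := by positivity
  have hcross : n * t * (1 + B) * (q * (n * t + lam * (1 / κ + 1)) / (n * κ / 2)) ≤
      lam * (c * (2 * (1 + B) * a)) := by
    calc _ = (1 + B) * (q * t) * (n * t + lam * (1 / κ + 1)) * (2 / κ) := by field_simp
      _ ≤ (1 + B) * c * (lam * (κ * a)) * (2 / κ) := by
          have := h.dim_mul_error_le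
          gcongr
      _ = lam * (c * (2 * (1 + B) * a)) := by field_simp
  have hnoise : (1 + B) * (n * t) ≤ (1 + B) * (c * lam) :=
    mul_le_mul_of_nonneg_left h.noise_le (by positivity)
  have herror : lam * (1 + B) * t ≤ lam * (1 + B) * c :=
    mul_le_mul_of_nonneg_left h.error_le (by positivity)
  have hmargin : lam * (c * (2 * (1 + B) * (1 + a))) < lam * (η * v) := by
    rw [rateFactor, ← ha] at hη
    exact mul_lt_mul_of_pos_left (hη.trans_le (le_mul_of_one_le_right hη0.le hv)) hlam
  linarith

end RatesWithin

lemma SampleMomentsClose.coerciveWith_toBlocks₁₁ {m ι ι' : Type*} [Fintype m] [Fintype ι]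
    [Fintype ι'] {X : Matrix m (ι ⊕ ι') ℝ} {e : m → ℝ} {C : Matrix (ι ⊕ ι') (ι ⊕ ι') ℝ}
    (h : SampleMomentsClose X e C t) (hC : CoerciveWith κ C) (ht : 0 ≤ t)
    (hcard : Fintype.card ι * t ≤ κ / 2) :
    CoerciveWith (Fintype.card m * κ / 2) (Xᵀ * X).toBlocks₁₁ := by
  refine ((hC.smul (Nat.cast_nonneg (Fintype.card m))).toBlocks₁₁.of_abs_sub_le
    (mul_nonneg (Nat.cast_nonneg _) ht) fun k l => h.gram (.inl k) (.inl l)).mono ?_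
  have := mul_le_mul_of_nonneg_left hcard (Nat.cast_nonneg (α := ℝ) (Fintype.card m))
  linarith

lemma abs_dotProduct_sqrt_mul_le {ι : Type*} [Fintype ι] {a d v s : ι → ℝ}
    (hd : ∀ i, 0 ≤ d i) (hv : ∀ i, 1 ≤ v i) (hdv : ∀ i, |d i - v i| ≤ t) (hs : ∀ i, |s i| ≤ 1)
    (ht : 0 ≤ t) (ha : ∑ i, |a i| ≤ B) :
    |a ⬝ᵥ fun i => √(d i) * s i| ≤ |a ⬝ᵥ fun i => √(v i) * s i| + B * t := by
  have hdiff i : |(√(d i) - √(v i)) * s i| ≤ t := by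
    rw [abs_mul]
    exact (mul_le_of_le_one_right (abs_nonneg _) (hs i)).trans
      ((abs_sqrt_sub_sqrt_le (hd i) (hv i)).trans (hdv i))
  have hsplit : (fun i => √(d i) * s i) =
      (fun i => √(v i) * s i) + fun i => (√(d i) - √(v i)) * s i := by
    ext i
    simp only [Pi.add_apply]
    ring
  rw [hsplit, dotProduct_add]
  exact (abs_add_le _ _).trans (add_le_add_right
    ((abs_dotProduct_le_sum_abs_mul hdiff).trans (mul_le_mul_of_nonneg_right ha ht)) _)

lemma response_eq_mulVec_add {β : Fin q ⊕ Fin r → ℝ} (hβ : ∀ j, β (.inr j) = 0)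
    (x : Fin n → EuclideanSpace ℝ (Fin q ⊕ Fin r)) (ε : Fin n → ℝ) :
    response x β ε = designMatrix x *ᵥ Sum.elim (fun i => β (.inl i)) 0 + ε := by
  ext i
  simp [response, designMatrix, mulVec, dotProduct, hβ]

/-- The conditions on the covariance matrix `C` and the signs of the SPACs `γ` under which
SPAC-Lasso recovers these signs; the consistency theorem requires them with constants `κ`, `B` and
`η` that do not depend on the sample size. -/
structure RegularCovariance (κ B η : ℝ) (C : Matrix (Fin q ⊕ Fin r) (Fin q ⊕ Fin r) ℝ)
    (γ : Fin q ⊕ Fin r → ℝ) : Prop where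
  posDef : C.PosDef
  apply_self : ∀ k, C k k = 1
  coerciveWith : CoerciveWith κ C
  sum_abs_le : ∀ j, ∑ i, |(C.toBlocks₂₁ * C.toBlocks₁₁⁻¹) j i| ≤ B
  abs_irrep_le : ∀ j, |transformedIrrepVector C γ j| ≤ 1 - η

namespace RegularCovariance

variable {γ : Fin q ⊕ Fin r → ℝ}

lemma one_le_inv_apply_self (h : RegularCovariance κ B η C γ) (k : Fin q ⊕ Fin r) :
    1 ≤ C⁻¹ k k :=
  _root_.one_le_inv_apply_self h.posDef (h.apply_self k)

lemma sqrt_inv_apply_self_le (h : RegularCovariance κ B η C γ) (hκ : 0 < κ) (k : Fin q ⊕ Fin r) :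
    √(C⁻¹ k k) ≤ 1 / κ :=
  have hv := h.one_le_inv_apply_self k
  (Real.sqrt_le_iff.2 ⟨by linarith, by nlinarith⟩).trans
    (h.coerciveWith.inv_apply_self_le hκ h.posDef k)

lemma abs_dotProduct_sqrt_inv_mul_sign_le (h : RegularCovariance κ B η C γ) (j : Fin r) :
    |(C.toBlocks₂₁ * C.toBlocks₁₁⁻¹) j ⬝ᵥ fun i : Fin q =>
      √(C⁻¹ (.inl i) (.inl i)) * SignType.sign (γ (.inl i))| ≤
        (1 - η) * √(C⁻¹ (.inr j) (.inr j)) := by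
  have hd : 0 < √(C⁻¹ (.inr j) (.inr j)) := Real.sqrt_pos.2 h.posDef.inv.diag_pos
  have hirrep := h.abs_irrep_le j
  rwa [transformedIrrepVector_apply h.posDef, abs_div, abs_of_pos hd, div_le_iff₀ hd] at hirrep

lemma abs_dotProduct_weight_mul_sign_le (h : RegularCovariance κ B η C γ) {d : Fin q ⊕ Fin r → ℝ}
    (hd0 : ∀ k, 0 ≤ d k) (hd : ∀ k, |d k - C⁻¹ k k| ≤ t) (ht : 0 ≤ t) (hlam : 0 ≤ lam)
    (j : Fin r) :
    |(C.toBlocks₂₁ * C.toBlocks₁₁⁻¹) j ⬝ᵥ fun i : Fin q =>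
      lam * √(d (.inl i)) * SignType.sign (γ (.inl i))| ≤
        lam * ((1 - η) * √(C⁻¹ (.inr j) (.inr j)) + B * t) := by
  have hestimate := abs_dotProduct_sqrt_mul_le (s := fun i => (SignType.sign (γ (.inl i)) : ℝ))
    (fun i => hd0 (.inl i)) (fun i => h.one_le_inv_apply_self (.inl i)) (fun i => hd (.inl i))
    (fun i => by cases SignType.sign (γ (.inl i)) <;> simp) ht (h.sum_abs_le j)
  simp_rw [mul_assoc lam, ← smul_eq_mul lam, ← Pi.smul_def, dotProduct_smul, smul_eq_mul, abs_mul,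
    abs_of_nonneg hlam]
  exact mul_le_mul_of_nonneg_left
    (hestimate.trans (add_le_add_left (h.abs_dotProduct_sqrt_inv_mul_sign_le j) _)) hlam

end RegularCovariance

theorem spacLasso_sign_eq_of_sampleMomentsClose {β γ : Fin q ⊕ Fin r → ℝ}
    (hC : RegularCovariance κ B η C γ) (hκ : 0 < κ) (hB : 0 ≤ B)
    (hβ : ∀ j, β (.inr j) = 0) (hγβ : ∀ k, SignType.sign (γ k) = SignType.sign (β k))
    {x : Fin n → EuclideanSpace ℝ (Fin q ⊕ Fin r)} {ε : Fin n → ℝ} {d : Fin q ⊕ Fin r → ℝ}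
    (hmoments : SampleMomentsClose (designMatrix x) ε C t) (hd : ∀ k, |d k - C⁻¹ k k| ≤ t)
    (ht : 0 ≤ t) (hl : 0 < l) (hlβ : ∀ i, l ≤ |β (.inl i)|) (hlam : 0 < lam) (hn : 0 < n)
    (hrates : RatesWithin c q n t lam l) (hc : c * rateFactor κ B < 1)
    (hη : c * rateFactor κ B < η) :
    (∃ g, IsSpacLasso x (response x β ε) d lam g) ∧ ∀ g, IsSpacLasso x (response x β ε) d lam g →
      ∀ j, SignType.sign (g j) = SignType.sign (γ j) := by
  have hc0 : 0 ≤ c := ht.trans hrates.error_le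
  have hc1 : c < 1 := lt_one_of_mul_rateFactor_lt_one hκ hB hc
  have hv1 := hC.one_le_inv_apply_self
  have hd0 k : 0 < d k := by linarith [hv1 k, (abs_le.1 (hd k)).1, hrates.error_le]
  have hsqrt k : |√(d k) - √(C⁻¹ k k)| ≤ t :=
    (abs_sqrt_sub_sqrt_le (hd0 k).le (hv1 k)).trans (hd k)
  have hcoer : CoerciveWith (n * κ / 2) ((designMatrix x)ᵀ * designMatrix x).toBlocks₁₁ := by
    have hqt := hrates.dim_mul_error_le.trans (le_div_four_of_mul_rateFactor_le_one hc0 hκ hB hc.le)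
    simpa using hmoments.coerciveWith_toBlocks₁₁ hC.coerciveWith ht
      (by rw [Fintype.card_fin]; linarith)
  have hsignal i := (hrates.signal_lt hc0 hκ hB hc hlam.le hn hl).trans_le
    (mul_le_mul_of_nonneg_left (hlβ i) (by positivity))
  have hdual j := calc
    _ ≤ _ := add_le_add_left (add_le_add_right
      (hC.abs_dotProduct_weight_mul_sign_le (fun k => (hd0 k).le) hd ht hlam.le j)
        (n * t + B * (n * t))) (n * t * (1 + B) * (q * (n * t + lam * (1 / κ + 1)) / (n * κ / 2)))
    _ < lam * (√(C⁻¹ (.inr j) (.inr j)) - t) :=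
      hrates.dual_lt hc0 hκ hB hc hη ht hlam hn (Real.one_le_sqrt.2 (hv1 (.inr j)))
    _ ≤ lam * √(d (.inr j)) :=
      mul_le_mul_of_nonneg_left (by linarith [(abs_le.1 (hsqrt (.inr j))).1]) hlam.le
  have hweight (i : Fin q) : lam * √(d (.inl i)) ≤ lam * (1 / κ + 1) := by
    have hv := hC.sqrt_inv_apply_self_le hκ (.inl i)
    have hdv := (abs_le.1 (hsqrt (.inl i))).2
    exact mul_le_mul_of_nonneg_left (by linarith [hrates.error_le]) hlam.le
  obtain ⟨h₀, hmin, hsign⟩ := exists_isLassoMin_iff_eq_and_sign_eq (X := designMatrix x) (e := ε)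
    (p := fun k => lam * √(d k)) (b := fun i => β (.inl i)) (P := lam * (1 / κ + 1))
    (toBlocks₂₁_smul_eq_mul hC.posDef n) (by simpa using hmoments.gram)
    (by simpa using hmoments.noise) (by positivity) hcoer hC.sum_abs_le (fun i => by positivity)
    hweight (by simpa only [Fintype.card_fin] using hsignal)
    (by simpa only [Fintype.card_fin, hγβ] using hdual)
  simp_rw [hγβ]
  rw [response_eq_mulVec_add hβ]
  exact exists_isSpacLasso_and_sign_eq hd0 hmin fun k => (hsign k).trans (by cases k <;> simp [hβ])

end SpacLasso

section Consistency

lemma tendsto_mul_sqrt_log_div_self {q : ℕ → ℝ}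
    (hq : q =o[atTop] fun n : ℕ => √(n / Real.log n)) :
    Tendsto (fun n : ℕ => q n * √(Real.log n / n)) atTop (𝓝 0) := by
  refine (isLittleO_one_iff ℝ).1
    ((hq.mul_isBigO (isBigO_refl (fun n : ℕ => √(Real.log n / n)) _)).trans_eventuallyEq ?_)
  filter_upwards [eventually_gt_atTop 1] with n hn
  have hn₁ : (1 : ℝ) < n := Nat.one_lt_cast.2 hn
  have hlog : Real.log n ≠ 0 := (Real.log_pos hn₁).ne'
  rw [← Real.sqrt_mul (div_nonneg (by positivity) (Real.log_pos hn₁).le),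
    div_mul_div_cancel₀ hlog, div_self (by positivity), Real.sqrt_one]

lemma natCast_mul_sqrt_log_div_self (n : ℕ) :
    n * √(Real.log n / n) = √(n * Real.log n) := by
  rcases n.eq_zero_or_pos with rfl | hn
  · simp
  rw [mul_comm, ← Real.sqrt_sq (Nat.cast_nonneg (α := ℝ) n), ← Real.sqrt_mul' _ (by positivity),
    Real.sqrt_sq (Nat.cast_nonneg n)]
  congr 1
  field_simp

variable {q r : ℕ → ℕ} {l lam : ℕ → ℝ}

lemma eventually_ratesWithin (hq : (fun n => (q n : ℝ)) =o[atTop] fun n : ℕ => √(n / Real.log n))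
    (hl : ∀ n, 0 < l n) (hlam : ∀ n, 0 ≤ lam n)
    (hlam₁ : (fun n : ℕ => √(n * Real.log n)) =o[atTop] lam)
    (hlam₂ : (fun n : ℕ => √(q n) * lam n / n) =o[atTop] l) (M : ℝ) {c : ℝ} (hc : 0 < c) :
    ∀ᶠ n in atTop, RatesWithin c (q n) n (M * √(Real.log n / n)) (lam n) (l n) := by
  have herror : Tendsto (fun n : ℕ => M * √(Real.log n / n)) atTop (𝓝 0) := by
    simpa using tendsto_log_div_self_atTop.sqrt.const_mul M
  have hdim : Tendsto (fun n : ℕ => M * (q n * √(Real.log n / n))) atTop (𝓝 0) := by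
    simpa using (tendsto_mul_sqrt_log_div_self hq).const_mul M
  filter_upwards [herror.eventually_le_const hc, hdim.eventually_le_const hc,
    (hlam₁.const_mul_left M).bound hc, hlam₂.bound hc, eventually_gt_atTop 0] with n h₁ h₂ h₃ h₄ hn
  refine ⟨h₁, (mul_left_comm ..).trans_le h₂, ?_, ?_⟩
  · rw [mul_left_comm, natCast_mul_sqrt_log_div_self]
    exact (le_abs_self _).trans (h₃.trans_eq (by rw [Real.norm_of_nonneg (hlam n)]))
  · rw [Real.norm_of_nonneg (by have := hlam n; positivity), Real.norm_of_nonneg (hl n).le,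
      div_le_iff₀ (by positivity)] at h₄
    exact h₄.trans_eq (by ring)

lemma eventually_pos_of_sqrt_isLittleO (hlam : ∀ n, 0 ≤ lam n)
    (hlam₁ : (fun n : ℕ => √(n * Real.log n)) =o[atTop] lam) : ∀ᶠ n in atTop, 0 < lam n := by
  filter_upwards [hlam₁.bound one_pos, eventually_gt_atTop 1] with n hn hn₁
  have hlog : 0 < Real.log n := Real.log_pos (Nat.one_lt_cast.2 hn₁)
  rw [one_mul, Real.norm_of_nonneg (Real.sqrt_nonneg _), Real.norm_of_nonneg (hlam n)] at hn
  exact (Real.sqrt_pos.2 (by positivity)).trans_le hn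

variable {Ω : Type*} [MeasurableSpace Ω] {μ : Measure Ω} [IsProbabilityMeasure μ]
  {C : ∀ n, Matrix (Fin (q n) ⊕ Fin (r n)) (Fin (q n) ⊕ Fin (r n)) ℝ}
  {β : ∀ n, Fin (q n) ⊕ Fin (r n) → ℝ} {σ : ℕ → ℝ}
  {x : ∀ n, Ω → Fin n → EuclideanSpace ℝ (Fin (q n) ⊕ Fin (r n))} {ε : ∀ n, Ω → Fin n → ℝ}
  {dhat : ∀ n, Ω → Fin (q n) ⊕ Fin (r n) → ℝ}

lemma exists_tendsto_measure_not_close {κ B η s τ : ℝ}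
    (hC : ∀ᶠ n in atTop, RegularCovariance κ B η (C n) (spac (jointCov (C n) (β n) (σ n))))
    (hσ : ∀ n, |σ n| ≤ s) (hdata : ∀ n, IsGaussianSample μ (C n) (σ n) (x n) (ε n))
    (hdhat : ∃ M : ℝ, Tendsto (fun n => μ {ω | ¬ ∀ j, |dhat n ω j - (C n)⁻¹ j j| ≤
      M * √(Real.log n / n)}) atTop (𝓝 0))
    (hp : (fun n => ((q n + r n : ℕ) : ℝ)) =O[atTop] fun n : ℕ => (n : ℝ) ^ τ) :
    ∃ M : ℝ, 0 ≤ M ∧ Tendsto (fun n => μ {ω | ¬ (SampleMomentsClose (designMatrix (x n ω)) (ε n ω)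
      (C n) (M * √(Real.log n / n)) ∧
        ∀ j, |dhat n ω j - (C n)⁻¹ j j| ≤ M * √(Real.log n / n))}) atTop (𝓝 0) := by
  obtain ⟨M₁, hM₁⟩ := hdhat
  have hvar : ∀ᶠ n in atTop, ∀ k, 4 * C n k k + σ n ^ 2 ≤ 4 + s ^ 2 := by
    filter_upwards [hC] with n hn k
    rw [hn.apply_self, mul_one]
    exact add_le_add_right (sq_le_sq' (abs_le.1 (hσ n)).1 (abs_le.1 (hσ n)).2) _
  obtain ⟨M, hM, hMmax⟩ := ((eventually_tendsto_measure_not_sampleMomentsClose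
    (hC.mono fun n hn => hn.posDef.posSemidef) (by positivity) hvar hdata
    (by simpa using hp)).and (eventually_ge_atTop (max M₁ 0))).exists
  have hsum := hM.add hM₁
  rw [add_zero] at hsum
  refine ⟨M, (le_max_right _ _).trans hMmax, tendsto_of_tendsto_of_tendsto_of_le_of_le
    tendsto_const_nhds hsum (fun _ => zero_le) fun n =>
      (measure_mono fun ω hω => ?_).trans (measure_union_le _ _)⟩
  refine (not_and_or.1 hω).imp id fun hfar hclose => hfar fun j => (hclose j).trans ?_
  exact mul_le_mul_of_nonneg_right ((le_max_left _ _).trans hMmax) (Real.sqrt_nonneg _)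

theorem signConsistentAlong_of_regularCovariance {κ B η s τ : ℝ} (hκ : 0 < κ) (hB : 0 ≤ B)
    (hη : 0 < η)
    (hC : ∀ᶠ n in atTop, RegularCovariance κ B η (C n) (spac (jointCov (C n) (β n) (σ n))))
    (hβ : ∀ n j, β n (.inr j) = 0) (hσ : ∀ n, |σ n| ≤ s)
    (hdata : ∀ n, IsGaussianSample μ (C n) (σ n) (x n) (ε n))
    (hdhat : ∃ M : ℝ, Tendsto (fun n => μ {ω | ¬ ∀ j, |dhat n ω j - (C n)⁻¹ j j| ≤
      M * √(Real.log n / n)}) atTop (𝓝 0))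
    (hp : (fun n => ((q n + r n : ℕ) : ℝ)) =O[atTop] fun n : ℕ => (n : ℝ) ^ τ)
    (hq : (fun n => (q n : ℝ)) =o[atTop] fun n : ℕ => √(n / Real.log n)) (hl : ∀ n, 0 < l n)
    (hγl : ∀ n i, l n ≤ |spac (jointCov (C n) (β n) (σ n)) (.inl i)|) (hlam : ∀ n, 0 ≤ lam n)
    (hlam₁ : (fun n : ℕ => √(n * Real.log n)) =o[atTop] lam)
    (hlam₂ : (fun n : ℕ => √(q n) * lam n / n) =o[atTop] l) :
    SignConsistentAlong μ q r x (fun n ω => response (x n ω) (β n) (ε n ω)) dhat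
      (fun n => spac (jointCov (C n) (β n) (σ n))) lam := by
  obtain ⟨M, hM0, hM⟩ := exists_tendsto_measure_not_close hC hσ hdata hdhat hp
  obtain ⟨c, hc0, hc⟩ := exists_pos_mul_lt (lt_min one_pos hη) (rateFactor κ B)
  rw [mul_comm, lt_min_iff] at hc
  refine tendsto_of_tendsto_of_tendsto_of_le_of_le' tendsto_const_nhds hM
    (Eventually.of_forall fun _ => zero_le) ?_
  filter_upwards [eventually_ratesWithin hq hl hlam hlam₁ hlam₂ M hc0, hC,
    eventually_pos_of_sqrt_isLittleO hlam hlam₁, eventually_gt_atTop 0] with n hrates hCn hlamn hn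
  refine measure_mono fun ω hω hclose => hω ?_
  exact spacLasso_sign_eq_of_sampleMomentsClose hCn hκ hB (hβ n)
    (sign_spac_jointCov hCn.posDef _ _) hclose.1 hclose.2 (by positivity) (hl n)
    (fun i => (hγl n i).trans (abs_spac_jointCov_le hCn.posDef (hCn.one_le_inv_apply_self _) _ _))
    hlamn hn hrates hc.1 hc.2

end Consistency

section Exchangeable

variable {q r : ℕ} {α₁ α₂ α₃ : ℝ}

lemma exchangeableCov_apply_self (k : Fin q ⊕ Fin r) : exchangeableCov q r α₁ α₂ α₃ k k = 1 := by
  cases k <;> simp [exchangeableCov]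

lemma sum_ite_one_mul {ι : Type*} [Fintype ι] [DecidableEq ι] (a : ℝ) (v : ι → ℝ) (i : ι) :
    ∑ k, (if i = k then 1 else a) * v k = (1 - a) * v i + a * ∑ k, v k := by
  have hsplit k : (if i = k then 1 else a) * v k =
      (if i = k then (1 - a) * v k else 0) + a * v k := by
    split_ifs <;> ring
  simp only [hsplit, Finset.sum_add_distrib, Finset.sum_ite_eq, Finset.mem_univ, if_true,
    Finset.mul_sum]

lemma exchangeableCov_dotProduct_mulVec (v : Fin q ⊕ Fin r → ℝ) :
    v ⬝ᵥ exchangeableCov q r α₁ α₂ α₃ *ᵥ v =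
      (1 - α₁) * ∑ i, v (.inl i) ^ 2 + (1 - α₃) * ∑ j, v (.inr j) ^ 2 +
        (α₁ * (∑ i, v (.inl i)) ^ 2 + 2 * α₂ * (∑ i, v (.inl i)) * ∑ j, v (.inr j) +
          α₃ * (∑ j, v (.inr j)) ^ 2) := by
  have hdiag {m : ℕ} (a : ℝ) (x : Fin m → ℝ) :
      ∑ i, x i * ((1 - a) * x i) = (1 - a) * ∑ i, x i ^ 2 := by
    rw [Finset.mul_sum]
    exact Finset.sum_congr rfl fun i _ => by ring
  simp only [dotProduct, mulVec, Fintype.sum_sum_type, exchangeableCov, fromBlocks_apply₁₁,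
    fromBlocks_apply₁₂, fromBlocks_apply₂₁, fromBlocks_apply₂₂, of_apply, sum_ite_one_mul,
    ← Finset.mul_sum, mul_add, Finset.sum_add_distrib, ← Finset.sum_mul, hdiag]
  ring

lemma nonneg_form_of_posDef_exchangeableCov {q r : ℕ → ℕ} (hq : Tendsto q atTop atTop)
    (hr : Tendsto r atTop atTop) (hC : ∀ n, (exchangeableCov (q n) (r n) α₁ α₂ α₃).PosDef)
    (u w : ℝ) : 0 ≤ α₁ * u ^ 2 + 2 * α₂ * u * w + α₃ * w ^ 2 := by
  have hlim : Tendsto (fun n => (1 - α₁) * u ^ 2 / q n + (1 - α₃) * w ^ 2 / r n +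
      (α₁ * u ^ 2 + 2 * α₂ * u * w + α₃ * w ^ 2)) atTop
      (𝓝 (0 + 0 + (α₁ * u ^ 2 + 2 * α₂ * u * w + α₃ * w ^ 2))) :=
    (((tendsto_natCast_atTop_atTop.comp hq).const_div_atTop _).add
      ((tendsto_natCast_atTop_atTop.comp hr).const_div_atTop _)).add_const _
  rw [zero_add, zero_add] at hlim
  refine ge_of_tendsto hlim ?_
  filter_upwards [hq.eventually_gt_atTop 0, hr.eventually_gt_atTop 0] with n hqn hrn
  have h := (hC n).posSemidef.dotProduct_mulVec_nonneg
    (Sum.elim (fun _ => u / q n) fun _ => w / r n)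
  rw [star_trivial, exchangeableCov_dotProduct_mulVec] at h
  simp only [Sum.elim_inl, Sum.elim_inr, Finset.sum_const, Finset.card_univ, Fintype.card_fin,
    nsmul_eq_mul] at h
  convert h using 1
  field_simp

lemma sum_ite_sub_inv_card_sq {ι : Type*} [Fintype ι] [DecidableEq ι] (j : ι) :
    ∑ k : ι, ((if k = j then 1 else 0) - 1 / Fintype.card ι : ℝ) ^ 2 = 1 - 1 / Fintype.card ι := by
  have hcard : (Fintype.card ι : ℝ) ≠ 0 := by
    have : Nonempty ι := ⟨j⟩
    simp
  simp only [sub_sq, ite_pow, one_pow, ne_eq, OfNat.ofNat_ne_zero, not_false_eq_true, zero_pow,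
    mul_ite, mul_one, mul_zero, ite_mul, zero_mul, Finset.sum_add_distrib, Finset.sum_sub_distrib,
    Finset.sum_ite_eq', Finset.mem_univ, if_true, Finset.sum_const, Finset.card_univ, nsmul_eq_mul]
  field_simp
  ring

-- The test vector is the multiple of the centred `j`-th basis vector of the second block at which
-- the variational lower bound for the inverse is largest.
lemma le_inv_exchangeableCov_inr (hC : (exchangeableCov q r α₁ α₂ α₃).PosDef) (h₃ : α₃ < 1)
    (j : Fin r) :
    (1 - 1 / r) / (1 - α₃) ≤ (exchangeableCov q r α₁ α₂ α₃)⁻¹ (.inr j) (.inr j) := by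
  have hr : (r : ℝ) ≠ 0 := Nat.cast_ne_zero.2 (Fin.pos j).ne'
  have hα₃ : 1 - α₃ ≠ 0 := (sub_pos.2 h₃).ne'
  set w : Fin r → ℝ := fun k => ((if k = j then 1 else 0) - 1 / r) with hw
  have hsum : ∑ k, w k = 0 := by simp [hw, hr]
  have hsq : ∑ k, w k ^ 2 = 1 - 1 / r := by
    simpa only [Fintype.card_fin] using sum_ite_sub_inv_card_sq j
  refine le_trans (le_of_eq ?_) (two_mul_sub_dotProduct_mulVec_le_inv hC (.inr j)
    (Sum.elim 0 fun k => w k / (1 - α₃)))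
  rw [exchangeableCov_dotProduct_mulVec]
  simp only [Sum.elim_inl, Sum.elim_inr, Pi.zero_apply, ← Finset.sum_div, div_pow, hsum, hsq,
    show w j = 1 - 1 / r by simp [hw]]
  simp only [ne_eq, OfNat.ofNat_ne_zero, not_false_eq_true, zero_pow, Finset.sum_const_zero,
    mul_zero, zero_div, add_zero, zero_add]
  field_simp
  ring

lemma exchangeableCov_submatrix_sumCongr (e : Equiv.Perm (Fin q)) (f : Equiv.Perm (Fin r)) :
    (exchangeableCov q r α₁ α₂ α₃).submatrix (e.sumCongr f) (e.sumCongr f) =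
      exchangeableCov q r α₁ α₂ α₃ := by
  ext (i | i) (k | k) <;> simp [exchangeableCov]

lemma inv_exchangeableCov_inl_eq (i k : Fin q) :
    (exchangeableCov q r α₁ α₂ α₃)⁻¹ (.inl i) (.inl i) =
      (exchangeableCov q r α₁ α₂ α₃)⁻¹ (.inl k) (.inl k) := by
  conv_rhs =>
    rw [← exchangeableCov_submatrix_sumCongr (Equiv.swap k i) (Equiv.refl _), inv_submatrix_equiv]
  simp

lemma natCast_signImbalance (γ : Fin q ⊕ Fin r → ℝ) :
    (signImbalance γ : ℝ) = |∑ i, (SignType.sign (γ (.inl i)) : ℝ)| := by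
  rw [signImbalance, Nat.cast_natAbs, Int.cast_abs, Int.cast_sum]
  simp only [SignType.intCast_cast]

variable (hα : ∀ u w : ℝ, 0 ≤ α₁ * u ^ 2 + 2 * α₂ * u * w + α₃ * w ^ 2)
include hα

lemma left_nonneg_of_nonneg_form : 0 ≤ α₁ := by simpa using hα 1 0

lemma cross_eq_zero_of_nonneg_form (h : α₁ = 0) : α₂ = 0 := by
  have hdiscrim := discrim_le_zero fun u => (hα u 1).trans_eq (by ring :
    _ = α₁ * (u * u) + 2 * α₂ * u + α₃)
  rw [discrim, h] at hdiscrim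
  nlinarith [sq_nonneg α₂]

lemma coerciveWith_exchangeableCov :
    CoerciveWith (min (1 - α₁) (1 - α₃)) (exchangeableCov q r α₁ α₂ α₃) := fun v => by
  rw [exchangeableCov_dotProduct_mulVec, dotProduct, Fintype.sum_sum_type]
  simp only [← sq]
  rw [mul_add]
  refine (add_le_add ?_ ?_).trans (le_add_of_nonneg_right (hα _ _))
  · exact mul_le_mul_of_nonneg_right (min_le_left _ _) (Finset.sum_nonneg fun i _ => sq_nonneg _)
  · exact mul_le_mul_of_nonneg_right (min_le_right _ _) (Finset.sum_nonneg fun i _ => sq_nonneg _)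

variable (hC : (exchangeableCov q r α₁ α₂ α₃).PosDef) (h₁ : α₁ < 1) (h₃ : α₃ < 1)
include hC

include h₁ h₃ in
lemma inv_exchangeableCov_inl_le (i : Fin q) :
    (exchangeableCov q r α₁ α₂ α₃)⁻¹ (.inl i) (.inl i) ≤ 1 / (1 - α₁) := by
  refine inv_apply_self_le_of_mul_sq_le hC (sub_pos.2 h₁) fun v => ?_
  rw [exchangeableCov_dotProduct_mulVec]
  have hsingle : v (.inl i) ^ 2 ≤ ∑ k, v (.inl k) ^ 2 :=
    Finset.single_le_sum (f := fun k => v (.inl k) ^ 2) (fun k _ => sq_nonneg _)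
      (Finset.mem_univ i)
  have hrest : 0 ≤ (1 - α₃) * ∑ j, v (.inr j) ^ 2 :=
    mul_nonneg (sub_nonneg.2 h₃.le) (Finset.sum_nonneg fun j _ => sq_nonneg _)
  linarith [hα (∑ i, v (.inl i)) (∑ j, v (.inr j)),
    mul_le_mul_of_nonneg_left hsingle (sub_nonneg.2 h₁.le)]

include h₁ in
lemma exchangeableCov_toBlocks₂₁_mul_inv :
    (exchangeableCov q r α₁ α₂ α₃).toBlocks₂₁ * (exchangeableCov q r α₁ α₂ α₃).toBlocks₁₁⁻¹ =
      Matrix.of fun _ _ => α₂ / (1 - α₁ + q * α₁) := by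
  have hrow : 1 - α₁ + q * α₁ ≠ 0 := by
    have := left_nonneg_of_nonneg_form hα
    have := sub_pos.2 h₁
    positivity
  have h₁₁ : (exchangeableCov q r α₁ α₂ α₃).toBlocks₁₁.PosDef := hC.submatrix Sum.inl_injective
  have := h₁₁.isUnit.invertible
  rw [mul_inv_eq_iff_eq_mul_of_invertible]
  ext j i
  have h := sum_ite_one_mul α₁ (fun _ => α₂ / (1 - α₁ + q * α₁)) i
  simp only [Finset.sum_const, Finset.card_univ, Fintype.card_fin, nsmul_eq_mul] at h
  simp only [exchangeableCov, toBlocks_fromBlocks₁₁, toBlocks_fromBlocks₂₁, mul_apply, of_apply,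
    mul_comm (α₂ / _), eq_comm (b := i), h]
  rw [← mul_assoc, ← add_mul, mul_comm α₁, mul_div_cancel₀ _ hrow]

include h₁ h₃ in
lemma abs_sum_sqrt_inv_exchangeableCov_mul_sign_le (γ : Fin q ⊕ Fin r → ℝ) :
    |∑ i, √((exchangeableCov q r α₁ α₂ α₃)⁻¹ (.inl i) (.inl i)) * SignType.sign (γ (.inl i))| ≤
      √(1 / (1 - α₁)) * signImbalance γ := by
  rcases isEmpty_or_nonempty (Fin q) with _ | ⟨⟨k⟩⟩
  · simp [mul_nonneg]
  simp only [inv_exchangeableCov_inl_eq _ k, ← Finset.mul_sum]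
  rw [abs_mul, abs_of_nonneg (Real.sqrt_nonneg _), natCast_signImbalance]
  exact mul_le_mul_of_nonneg_right
    (Real.sqrt_le_sqrt (inv_exchangeableCov_inl_le hα hC h₁ h₃ k)) (abs_nonneg _)

include h₁ h₃ in
lemma abs_transformedIrrepVector_exchangeableCov_le (γ : Fin q ⊕ Fin r → ℝ) (hr : 1 < r)
    (j : Fin r) :
    |transformedIrrepVector (exchangeableCov q r α₁ α₂ α₃) γ j| ≤
      |α₂| / (1 - α₁ + q * α₁) * (√(1 / (1 - α₁)) * signImbalance γ) /
        √((1 - 1 / r) / (1 - α₃)) := by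
  have hrow : 0 ≤ 1 - α₁ + q * α₁ := by
    have := left_nonneg_of_nonneg_form hα
    have := sub_pos.2 h₁
    positivity
  have hr₁ : 0 < 1 - 1 / (r : ℝ) :=
    sub_pos.2 ((div_lt_one (by positivity)).2 (by exact_mod_cast hr))
  have hden : 0 < (1 - 1 / (r : ℝ)) / (1 - α₃) := div_pos hr₁ (sub_pos.2 h₃)
  rw [transformedIrrepVector_apply hC, exchangeableCov_toBlocks₂₁_mul_inv hα hC h₁]
  simp only [of_apply, ← Finset.mul_sum]
  rw [abs_div, abs_mul, abs_div, abs_of_nonneg hrow, abs_of_nonneg (Real.sqrt_nonneg _)]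
  refine div_le_div₀ (by positivity) (mul_le_mul_of_nonneg_left
    (abs_sum_sqrt_inv_exchangeableCov_mul_sign_le hα hC h₁ h₃ γ) (by positivity))
    (Real.sqrt_pos.2 hden) (Real.sqrt_le_sqrt (le_inv_exchangeableCov_inr hC h₃ j))

include h₁ h₃ in
lemma abs_transformedIrrepVector_exchangeableCov_le_of_le {γ : Fin q ⊕ Fin r → ℝ} {θ : ℝ}
    (hθ : 0 ≤ θ) (hm : 0 < signImbalance γ)
    (hα₂ : |α₂| ≤ θ * (√((1 - α₁) / (1 - α₃)) * α₁) * (q / signImbalance γ)) (hr : 1 < r)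
    (j : Fin r) :
    |transformedIrrepVector (exchangeableCov q r α₁ α₂ α₃) γ j| ≤ θ / √(1 - 1 / r) := by
  have hα₁ := left_nonneg_of_nonneg_form hα
  have h₁' := sub_pos.2 h₁
  have h₃' := sub_pos.2 h₃
  have : (0 : ℝ) < signImbalance γ := Nat.cast_pos.2 hm
  have hratio : q * α₁ / (1 - α₁ + q * α₁) ≤ 1 := by
    rw [div_le_one (by positivity)]
    linarith
  have hsqrt : √((1 - α₁) / (1 - α₃)) * √(1 / (1 - α₁)) * √(1 - α₃) = 1 := by
    rw [← Real.sqrt_mul (by positivity), ← Real.sqrt_mul (by positivity), Real.sqrt_eq_one]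
    field_simp
  refine (abs_transformedIrrepVector_exchangeableCov_le hα hC h₁ h₃ γ hr j).trans ?_
  rw [Real.sqrt_div' _ h₃'.le, div_div_eq_mul_div]
  refine div_le_div_of_nonneg_right ?_ (Real.sqrt_nonneg _)
  calc |α₂| / (1 - α₁ + q * α₁) * (√(1 / (1 - α₁)) * signImbalance γ) * √(1 - α₃)
      ≤ θ * (√((1 - α₁) / (1 - α₃)) * α₁) * (q / signImbalance γ) / (1 - α₁ + q * α₁) *
          (√(1 / (1 - α₁)) * signImbalance γ) * √(1 - α₃) := by gcongr
    _ = θ * (q * α₁ / (1 - α₁ + q * α₁)) *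
          (√((1 - α₁) / (1 - α₃)) * √(1 / (1 - α₁)) * √(1 - α₃)) := by
        field_simp
    _ ≤ θ := by
        rw [hsqrt, mul_one]
        exact mul_le_of_le_one_right hθ hratio

include h₁ in
lemma sum_abs_exchangeableCov_toBlocks₂₁_mul_inv_le (j : Fin r) :
    ∑ i, |((exchangeableCov q r α₁ α₂ α₃).toBlocks₂₁ *
      (exchangeableCov q r α₁ α₂ α₃).toBlocks₁₁⁻¹) j i| ≤ |α₂| / α₁ := by
  have h₁' := sub_pos.2 h₁
  rw [exchangeableCov_toBlocks₂₁_mul_inv hα hC h₁]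
  rcases (left_nonneg_of_nonneg_form hα).eq_or_lt with hα₁ | hα₁
  · simp [cross_eq_zero_of_nonneg_form hα hα₁.symm]
  have hrow : 0 < 1 - α₁ + q * α₁ := by positivity
  simp only [of_apply, Finset.sum_const, Finset.card_univ, Fintype.card_fin, nsmul_eq_mul, abs_div,
    abs_of_pos hrow]
  rw [mul_div_assoc', div_le_div_iff₀ hrow hα₁]
  nlinarith [mul_nonneg (abs_nonneg α₂) h₁'.le]

end Exchangeable

section CorrelationCondition

lemma exists_lt_one_eventually_le_of_le_liminf {ι : Type*} {f : Filter ι} {a c η : ℝ} {u : ι → ℝ}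
    (ha : 0 ≤ a) (hc : 0 ≤ c) (hη : 0 < η) (hu : ∀ n, 0 ≤ u n)
    (h : (a : EReal) ≤ ((1 - η) * c : ℝ) * liminf (fun n => (u n : EReal)) f) :
    ∃ θ < 1, 0 ≤ θ ∧ ∀ᶠ n in f, a ≤ θ * c * u n := by
  rcases ha.eq_or_lt with rfl | ha
  · exact ⟨0, one_pos, le_rfl, by simp⟩
  have hliminf : 0 ≤ liminf (fun n => (u n : EReal)) f :=
    le_liminf_of_le (by isBoundedDefault) (.of_forall fun n => EReal.coe_nonneg.2 (hu n))
  have hpos : 0 < (1 - η) * c := by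
    by_contra! hneg
    exact absurd (h.trans (EReal.mul_nonpos_iff.2 (.inr ⟨EReal.coe_nonpos.2 hneg, hliminf⟩)))
      (by simpa using ha)
  have hη₁ : 0 < 1 - η := pos_of_mul_pos_left hpos hc
  have hθc : (1 - η) * c < (1 - η / 2) * c := by nlinarith
  refine ⟨1 - η / 2, by linarith, by linarith, ?_⟩
  have hlt : ((a / ((1 - η / 2) * c) : ℝ) : EReal) < liminf (fun n => (u n : EReal)) f := by
    by_contra! hle
    have hbound : a ≤ (1 - η) * c * (a / ((1 - η / 2) * c)) := by
      exact_mod_cast h.trans (mul_le_mul_of_nonneg_left hle (EReal.coe_nonneg.2 hpos.le))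
    rw [mul_div_assoc', le_div_iff₀ (hpos.trans hθc), mul_comm] at hbound
    exact hbound.not_gt (mul_lt_mul_of_pos_right hθc ha)
  filter_upwards [eventually_lt_of_lt_liminf hlt] with n hn
  rw [mul_comm]
  exact ((div_lt_iff₀ (hpos.trans hθc)).1 (EReal.coe_lt_coe_iff.1 hn)).le

theorem exists_eventually_regularCovariance_exchangeableCov {q r : ℕ → ℕ}
    (hq : Tendsto q atTop atTop) (hr : Tendsto r atTop atTop) {α₁ α₂ α₃ : ℝ} (h₁ : α₁ < 1)
    (h₃ : α₃ < 1) (hC : ∀ n, (exchangeableCov (q n) (r n) α₁ α₂ α₃).PosDef)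
    {γ : ∀ n, Fin (q n) ⊕ Fin (r n) → ℝ} (hm : ∀ᶠ n in atTop, 0 < signImbalance (γ n)) {η : ℝ}
    (hη : 0 < η)
    (hcond : ((|α₂| : ℝ) : EReal) ≤ (((1 - η) * √((1 - α₁) / (1 - α₃)) * α₁ : ℝ) : EReal) *
      liminf (fun n => (((q n : ℝ) / (signImbalance (γ n) : ℝ) : ℝ) : EReal)) atTop) :
    ∃ η' : ℝ, 0 < η' ∧ ∀ᶠ n in atTop, RegularCovariance (min (1 - α₁) (1 - α₃)) (|α₂| / α₁) η'
      (exchangeableCov (q n) (r n) α₁ α₂ α₃) (γ n) := by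
  have hα := nonneg_form_of_posDef_exchangeableCov hq hr hC
  have hα₁ := left_nonneg_of_nonneg_form hα
  rw [mul_assoc] at hcond
  obtain ⟨θ, hθ₁, hθ₀, hθ⟩ := exists_lt_one_eventually_le_of_le_liminf (abs_nonneg _)
    (by positivity) hη (fun n => by positivity) hcond
  have hlim : Tendsto (fun n => θ / √(1 - 1 / r n)) atTop (𝓝 (θ / √(1 - 0))) :=
    tendsto_const_nhds.div
      (((tendsto_natCast_atTop_atTop.comp hr).const_div_atTop 1).const_sub 1).sqrt (by simp)
  rw [sub_zero, Real.sqrt_one, div_one] at hlim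
  refine ⟨(1 - θ) / 2, by linarith, ?_⟩
  filter_upwards [hm, hθ, hr.eventually_gt_atTop 1,
    hlim.eventually_le_const (show θ < 1 - (1 - θ) / 2 by linarith)] with n hmn hθn hrn hn
  exact {
    posDef := hC n
    apply_self := exchangeableCov_apply_self
    coerciveWith := coerciveWith_exchangeableCov hα
    sum_abs_le := sum_abs_exchangeableCov_toBlocks₂₁_mul_inv_le hα (hC n) h₁
    abs_irrep_le := fun j => (abs_transformedIrrepVector_exchangeableCov_le_of_le hα (hC n) h₁ h₃
      hθ₀ hmn hθn hrn j).trans hn }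

end CorrelationCondition

section GrowthConditions

lemma isLittleO_sqrt_div_log_of_isLittleO_rpow {q : ℕ → ℝ} {a : ℝ} (ha : a ≤ 1 / 2)
    (hq : q =o[atTop] fun n : ℕ => ((n : ℝ) / Real.log n) ^ a) :
    q =o[atTop] fun n : ℕ => √(n / Real.log n) := by
  refine hq.trans_isBigO (IsBigO.of_bound' ?_)
  filter_upwards [eventually_gt_atTop 1] with n hn
  have hlog : 0 < Real.log n := Real.log_pos (Nat.one_lt_cast.2 hn)
  rw [Real.norm_of_nonneg (by positivity), Real.norm_of_nonneg (by positivity), Real.sqrt_eq_rpow]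
  exact Real.rpow_le_rpow_of_exponent_le
    ((one_le_div hlog).2 (Real.log_le_self (Nat.cast_nonneg n))) ha

lemma isLittleO_sqrt_mul_log_of_tendsto_atTop {q : ℕ → ℕ} {lam : ℕ → ℝ}
    (hq : Tendsto q atTop atTop)
    (hlam : (fun n : ℕ => √((q n : ℝ) * n * Real.log n)) =o[atTop] lam) :
    (fun n : ℕ => √(n * Real.log n)) =o[atTop] lam := by
  refine (IsBigO.of_bound' ?_).trans_isLittleO hlam
  filter_upwards [hq.eventually_ge_atTop 1] with n hqn
  rw [Real.norm_of_nonneg (Real.sqrt_nonneg _), Real.norm_of_nonneg (Real.sqrt_nonneg _), mul_assoc]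
  exact Real.sqrt_le_sqrt (le_mul_of_one_le_left (mul_nonneg (Nat.cast_nonneg n)
    (Real.log_natCast_nonneg n)) (Nat.one_le_cast.2 hqn))

end GrowthConditions

theorem corollary1_general {Ω : Type*} [MeasurableSpace Ω] (μ : Measure Ω) [IsProbabilityMeasure μ]
    (q r : ℕ → ℕ) (hq : Tendsto q atTop atTop) (hr : Tendsto r atTop atTop)
    (α₁ α₂ α₃ : ℝ) (hα₁ : α₁ < 1) (hα₃ : α₃ < 1)
    (hC : ∀ n, (exchangeableCov (q n) (r n) α₁ α₂ α₃).PosDef)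
    (β : ∀ n, Fin (q n) ⊕ Fin (r n) → ℝ) (hβ : ∀ n j, β n (Sum.inr j) = 0)
    (hm : ∀ᶠ n in atTop, 0 < signImbalance (β n))
    (σ : ℕ → ℝ) (hσ : ∀ n, 0 < σ n) (hσ' : ∃ s : ℝ, ∀ n, σ n ≤ s)
    (γ : ∀ n, Fin (q n) ⊕ Fin (r n) → ℝ)
    (hγ : ∀ n j, γ n j =
      spac (jointCov (exchangeableCov (q n) (r n) α₁ α₂ α₃) (β n) (σ n)) j)
    (η : ℝ) (hη : 0 < η)
    (hcond : ((|α₂| : ℝ) : EReal) ≤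
      (((1 - η) * √((1 - α₁) / (1 - α₃)) * α₁ : ℝ) : EReal) *
        liminf (fun n => (((q n : ℝ) / (signImbalance (β n) : ℝ) : ℝ) : EReal)) atTop)
    (x : ∀ n, Ω → Fin n → EuclideanSpace ℝ (Fin (q n) ⊕ Fin (r n)))
    (ε : ∀ n, Ω → Fin n → ℝ)
    (hdata : ∀ n, IsGaussianSample μ (exchangeableCov (q n) (r n) α₁ α₂ α₃) (σ n) (x n) (ε n))
    (dhat : ∀ n, Ω → Fin (q n) ⊕ Fin (r n) → ℝ)
    (hdhat : ∃ M : ℝ, Tendsto (fun n => μ {ω | ¬ ∀ j,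
      |dhat n ω j - (exchangeableCov (q n) (r n) α₁ α₂ α₃)⁻¹ j j| ≤ M * √(Real.log n / n)})
        atTop (𝓝 0))
    (κ : ℝ) (hp : (fun n => ((q n + r n : ℕ) : ℝ)) =O[atTop] fun n : ℕ => (n : ℝ) ^ κ)
    (hqn : (fun n => (q n : ℝ)) =o[atTop] fun n : ℕ => √(n / Real.log n))
    (l : ℕ → ℝ) (hl : ∀ n, 0 < l n) (hγl : ∀ n i, l n ≤ |γ n (Sum.inl i)|)
    (lam : ℕ → ℝ) (hlam : ∀ n, 0 ≤ lam n)
    (hlam₁ : (fun n : ℕ => √(n * Real.log n)) =o[atTop] lam)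
    (hlam₂ : (fun n : ℕ => √(q n : ℝ) * lam n / n) =o[atTop] l) :
    TransformedStrongIrrepresentable q r (fun n => exchangeableCov (q n) (r n) α₁ α₂ α₃) γ ∧
      SignConsistentAlong μ q r x (fun n ω => response (x n ω) (β n) (ε n ω)) dhat γ lam ∧
      StronglySignConsistent μ q r x (fun n ω => response (x n ω) (β n) (ε n ω)) dhat γ := by
  obtain ⟨s, hs⟩ := hσ'
  obtain rfl : γ = fun n => spac (jointCov (exchangeableCov (q n) (r n) α₁ α₂ α₃) (β n) (σ n)) :=
    funext fun n => funext (hγ n)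
  have hsign n : signImbalance (spac (jointCov (exchangeableCov (q n) (r n) α₁ α₂ α₃)
      (β n) (σ n))) = signImbalance (β n) := by
    simp only [signImbalance, sign_spac_jointCov (hC n)]
  simp only [← hsign] at hm hcond
  obtain ⟨η', hη', hregular⟩ := exists_eventually_regularCovariance_exchangeableCov hq hr hα₁ hα₃ hC
    hm hη hcond
  have hcons := signConsistentAlong_of_regularCovariance
    (lt_min (sub_pos.2 hα₁) (sub_pos.2 hα₃)) (div_nonneg (abs_nonneg _)
      (left_nonneg_of_nonneg_form (nonneg_form_of_posDef_exchangeableCov hq hr hC))) hη' hregular hβ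
    (fun n => (abs_of_pos (hσ n)).trans_le (hs n)) hdata hdhat hp hqn hl hγl hlam hlam₁ hlam₂
  exact ⟨⟨η', hη', hregular.mono fun n hn => hn.abs_irrep_le⟩, hcons, lam, hlam, hcons⟩

theorem corollary1 {Ω : Type*} [MeasurableSpace Ω] (μ : Measure Ω) [IsProbabilityMeasure μ]
    -- numbers of relevant and of irrelevant covariates, and the covariance matrix
    (q r : ℕ → ℕ) (hq : Tendsto q atTop atTop) (hr : Tendsto r atTop atTop)
    (α₁ α₂ α₃ : ℝ) (hα₁ : α₁ ∈ Set.Ioo (-1 : ℝ) 1) (hα₃ : α₃ ∈ Set.Ioo (-1 : ℝ) 1)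
    (hC : ∀ n, (exchangeableCov (q n) (r n) α₁ α₂ α₃).PosDef)
    -- coefficients, noise level, SPACs
    (β : ∀ n, Fin (q n) ⊕ Fin (r n) → ℝ)
    (hβ₁ : ∀ n i, β n (Sum.inl i) ≠ 0) (hβ₂ : ∀ n j, β n (Sum.inr j) = 0)
    (hm : Tendsto (fun n => signImbalance (β n)) atTop atTop)
    (σ : ℕ → ℝ) (hσ : ∀ n, 0 < σ n) (hσ' : ∃ s : ℝ, ∀ n, σ n ≤ s)
    (γ : ∀ n, Fin (q n) ⊕ Fin (r n) → ℝ)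
    (hγ : ∀ n j, γ n j =
      spac (jointCov (exchangeableCov (q n) (r n) α₁ α₂ α₃) (β n) (σ n)) j)
    -- the condition on the correlations
    (η : ℝ) (hη : 0 < η)
    (hcond : ((|α₂| : ℝ) : EReal) ≤
      (((1 - η) * √((1 - α₁) / (1 - α₃)) * α₁ : ℝ) : EReal) *
        liminf (fun n => (((q n : ℝ) / (signImbalance (β n) : ℝ) : ℝ) : EReal)) atTop)
    -- the data and the estimator of the diagonal of the precision matrix
    (x : ∀ n, Ω → Fin n → EuclideanSpace ℝ (Fin (q n) ⊕ Fin (r n)))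
    (ε : ∀ n, Ω → Fin n → ℝ)
    (hdata : ∀ n, IsGaussianSample μ (exchangeableCov (q n) (r n) α₁ α₂ α₃) (σ n) (x n) (ε n))
    (dhat : ∀ n, Ω → Fin (q n) ⊕ Fin (r n) → ℝ)
    (hdhat : PrecisionEstimatorAccurate μ q r
      (fun n => exchangeableCov (q n) (r n) α₁ α₂ α₃) dhat)
    -- growth conditions on dimensions, signal strength and tuning parameters
    (κ : ℝ) (hκ : 0 ≤ κ)
    (hp : (fun n => ((q n + r n : ℕ) : ℝ)) =O[atTop] fun n : ℕ => (n : ℝ) ^ κ)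
    (hqn : (fun n => (q n : ℝ)) =o[atTop] fun n : ℕ => ((n : ℝ) / Real.log n) ^ (1 / 3 : ℝ))
    (l : ℕ → ℝ) (hl : ∀ n, 0 < l n) (hγl : ∀ n i, l n ≤ |γ n (Sum.inl i)|)
    (lam : ℕ → ℝ) (hlam : ∀ n, 0 ≤ lam n)
    (hlam₁ : (fun n : ℕ => √((q n : ℝ) * n * Real.log n)) =o[atTop] lam)
    (hlam₂ : Tendsto (fun n : ℕ => √(q n : ℝ) * lam n / n) atTop (𝓝 0))
    (hlam₃ : (fun n : ℕ => √(q n : ℝ) * lam n / n) =o[atTop] l) :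
    TransformedStrongIrrepresentable q r (fun n => exchangeableCov (q n) (r n) α₁ α₂ α₃) γ ∧
      SignConsistentAlong μ q r x (fun n ω => response (x n ω) (β n) (ε n ω)) dhat γ lam ∧
      StronglySignConsistent μ q r x (fun n ω => response (x n ω) (β n) (ε n ω)) dhat γ :=
  corollary1_general μ q r hq hr α₁ α₂ α₃ hα₁.2 hα₃.2 hC β hβ₂ (hm.eventually_gt_atTop 0) σ hσ hσ' γ
    hγ η hη hcond x ε hdata dhat hdhat.exists_tendsto_measure_zero κ hp
    (isLittleO_sqrt_div_log_of_isLittleO_rpow (by norm_num) hqn) l hl hγl lam hlam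
    (isLittleO_sqrt_mul_log_of_tendsto_atTop hq hlam₁) hlam₃
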